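/- **Proposition (optimal controls for the rank-one qubit).** Let $0\le\nu<1$, $V=\begin{pmatrix}0&1\\ \nu&0\end{pmatrix}$ and $\Gamma_V(\rho)=\tfrac12(V^*V\rho+\rho V^*V)-V\rho V^*$. Consider the control system on density matrices $\rho\in\mathbb C^{2\times2}$ $$\dot\rho(t)=-\mathrm i\,[u_x(t)\sigma_x+u_y(t)\sigma_y+u_z(t)\sigma_z,\rho(t)]-\Gamma_V(\rho(t)),\qquad(\mathsf F)$$ where $\sigma_x,\sigma_y,\sigma_z$ are the Pauli matrices and the controls $u_x,u_y,u_z$ are real and locally integrable; a solution on $[0,T]$ or $[0,\infty)$ is a (locally) absolutely continuous path of density matrices satisfying $(\mathsf F)$ almost everywhere. A number $\lambda\in[0,1]$ is a reduced state of $\rho$ if $\rho=U\,\mathrm{diag}(\lambda,1-\lambda)\,U^*$ for some $U\in\mathrm{SU}(2)$, and a reduced path of a path $\rho(t)$ is a continuous choice $\lambda(t)$ of reduced states of $\rho(t)$. Let $t_0=-\log\!\big(1-\tfrac{1+\nu^2}{1+\nu}\big)/(1+\nu^2)$ if $\nu>0$ and $t_0=\infty$ if $\nu=0$. Put $$\lambda^\star(t)=\begin{cases}\dfrac{1-e^{-(1+\nu^2)t}}{1+\nu^2}&0\le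 t\le t_0,\\[2mm] \tfrac12\big(1+\sqrt{1-c\,e^{-(1-\nu)^2t}}\big)&t>t_0,\end{cases}\qquad c=\frac{4\nu}{(1+\nu)^2}\Big(\frac{1+\nu}{\nu(1-\nu)}\Big)^{\frac{(1-\nu)^2}{1+\nu^2}},$$ $$y^\star(t)=0\ \ (0\le t\le t_0),\qquad y^\star(t)=\tfrac1\pi\arcsin\sqrt{\tfrac12\Big(1+\tfrac{1-\nu}{1+\nu}\,\tfrac1{1-2\lambda^\star(t)}\Big)}\ \ (t>t_0).$$ Let $\varepsilon\in\{1,-1\}$ and $\rho^\star(t)=U(t)\,\mathrm{diag}(\lambda^\star(t),1-\lambda^\star(t))\,U(t)^*$ with $U(t)=e^{-\varepsilon\mathrm i\pi y^\star(t)\sigma_y}$. Define $u_x=u_z\equiv0$ on $[0,\infty)$, $u_y\equiv0$ on $[0,t_0]$, and for $t>t_0$, writing $\lambda=\lambda^\star(t)$, $y=y^\star(t)$, let $u_y(t)=\varepsilon\,(D(t)+C(t))$ with the direct term $$D(t)=\frac{\frac1{2\lambda-1}\frac{1-\nu}{1+\nu}}{\sqrt{(2\lambda-1)^2-(\frac{1-\nu}{1+\nu})^2}}\cdot\Big(\frac{1-\nu}2\Big)^2\Big(\frac1{2\lambda-1}-(2\lambda-1)\Big)$$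 and the compensating term $$C(t)=\frac{(1+\nu)\sin(2\pi y)}4\Big(\frac{2(1-\nu)}{2\lambda-1}-(1+\nu)\cos(2\pi y)\Big).$$ Then $\rho^\star(0)=\mathrm{diag}(0,1)$ and $\lambda^\star(0)=0$, the controls $u_x,u_y,u_z$ are locally integrable on $[0,\infty)$, the path $\rho^\star$ solves $(\mathsf F)$ on $[0,\infty)$ with these controls, $\lambda^\star$ is a reduced path of $\rho^\star$, and $\lambda^\star(t)\to1$ as $t\to\infty$. The controls are time-optimal: let $s,T\ge0$ and let $\sigma$ be a solution of $(\mathsf F)$ on $[0,T]$ for arbitrary admissible controls. 1. If $m$ is a reduced path of $\sigma$ with $m(0)=\lambda^\star(s)$, then $m(T)\le\lambda^\star(s+T)$; and if $m(T)=\lambda^\star(t)$ for some $t\ge s$, then $t-s\le T$. 2. If $\lambda^\star(s)\ge\tfrac12$ and $\sigma(0)$ has the same eigenvalues as $\rho^\star(s)$, then $f(m,1-m)\le f(\lambda^\star(s+T),1-\lambda^\star(s+T))$ for every reduced state $m$ of $\sigma(T)$ and every Schur-convex function $f$ on $\{(p,q):p,q\ge0,\ p+q=1\}$. Moreover, for $t>t_0$,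 $D(t)=\pi\,\dot y^\star(t)$, and $C$ cancels the motion tangent to the unitary orbit induced by the drift, that is, $-\mathrm i[\varepsilon C(t)\sigma_y,\rho^\star(t)]-\Gamma_V(\rho^\star(t))$ commutes with $\rho^\star(t)$. -/

import Mathlib

open Set Filter Topology MeasureTheory
open scoped ComplexOrder

noncomputable section

namespace QubitCooling

/-- Operators on the qubit Hilbert space `ℂ²`. -/
abbrev Mat2 := Matrix (Fin 2) (Fin 2) ℂ

def σx : Mat2 := !![0, 1; 1, 0]

def σy : Mat2 := !![0, -Complex.I; Complex.I, 0]

def σz : Mat2 := !![1, 0; 0, -1]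

/-! ### The full bilinear control system -/

/-- The normal form of a non-normal Lindblad term on a qubit, `0 ≤ ν < 1`. -/
def lindbladTerm (ν : ℝ) : Mat2 := !![0, 1; (ν : ℂ), 0]

/-- `Γ_V(ρ) = ½ (V* V ρ + ρ V* V) - V ρ V*`; the dissipative drift is `-Γ_V`. -/
def dissipator (V ρ : Mat2) : Mat2 :=
  (1 / 2 : ℂ) • (V.conjTranspose * V * ρ + ρ * (V.conjTranspose * V)) - V * ρ * V.conjTranspose

/-- Density matrices: positive semidefinite and of unit trace. -/
def IsDensity (ρ : Mat2) : Prop := ρ.PosSemidef ∧ ρ.trace = 1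

/-- The control functions `u_x, u_y, u_z` belonging to the Pauli control Hamiltonians. -/
structure Controls where
  x : ℝ → ℝ
  y : ℝ → ℝ
  z : ℝ → ℝ

/-- The control Hamiltonian `u_x(t) σ_x + u_y(t) σ_y + u_z(t) σ_z`. -/
def Controls.hamiltonian (u : Controls) (t : ℝ) : Mat2 :=
  (u.x t : ℂ) • σx + (u.y t : ℂ) • σy + (u.z t : ℂ) • σz

/-- The right-hand side of the controlled master equation
`ρ' = -i [u_x σ_x + u_y σ_y + u_z σ_z, ρ] - Γ_V(ρ)`. -/
def masterField (ν : ℝ) (u : Controls) (t : ℝ) (ρ : Mat2) : Mat2 :=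
  -(Complex.I • ⁅u.hamiltonian t, ρ⁆) - dissipator (lindbladTerm ν) ρ

/-- `ρ` is a solution on the interval `I` of the full control system with controls `u`: the controls
are locally integrable on `I`, and `ρ` is a path of density matrices which is absolutely
continuous on compact subintervals of `I` and satisfies the master equation almost everywhere. -/
structure IsSolution (ν : ℝ) (I : Set ℝ) (u : Controls) (ρ : ℝ → Mat2) : Prop where
  locInt_x : LocallyIntegrableOn u.x I volume
  locInt_y : LocallyIntegrableOn u.y I volume
  locInt_z : LocallyIntegrableOn u.z I volume
  density : ∀ t ∈ I, IsDensity (ρ t)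
  absCont : ∀ a ∈ I, ∀ b ∈ I, ∀ i j, AbsolutelyContinuousOnInterval (fun t => ρ t i j) a b
  master : ∀ᵐ t ∂(volume.restrict I), ∀ i j,
    HasDerivAt (fun s => ρ s i j) (masterField ν u t (ρ t) i j) t

/-! ### Reduced states and cooling -/

/-- The diagonal density matrix `diag(l, 1 - l)` of the reduced state `l ∈ [0, 1]`. -/
def diagState (l : ℝ) : Mat2 := Matrix.diagonal ![(l : ℂ), ((1 - l : ℝ) : ℂ)]

/-- `l` is a reduced state of `ρ`: one has `ρ = U diag(l, 1 - l) U*` with `U ∈ SU(2)`. No ordering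
of the two eigenvalues is imposed. -/
def HasReducedState (ρ : Mat2) (l : ℝ) : Prop :=
  ∃ U ∈ Matrix.specialUnitaryGroup (Fin 2) ℂ, ρ = U * diagState l * U.conjTranspose

/-- `l` is a (continuous) path of reduced states of the path `ρ` on `I`. -/
def IsReducedPath (I : Set ℝ) (ρ : ℝ → Mat2) (l : ℝ → ℝ) : Prop :=
  ContinuousOn l I ∧ ∀ t ∈ I, HasReducedState (ρ t) (l t)

/-- Majorization `q ≼ p` in the simplex `Δ¹`: comparison of the sums of the `k` largest entries,
for `k = 1, 2`. -/
def Majorizes (p q : Fin 2 → ℝ) : Prop :=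
  max (q 0) (q 1) ≤ max (p 0) (p 1) ∧ q 0 + q 1 ≤ p 0 + p 1

/-- Schur-convexity of a function of the eigenvalues, i.e. of a function on the simplex `Δ¹`. -/
def SchurConvex (f : (Fin 2 → ℝ) → ℝ) : Prop :=
  ∀ p ∈ stdSimplex ℝ (Fin 2), ∀ q ∈ stdSimplex ℝ (Fin 2), Majorizes p q → f q ≤ f p

/-- The controls `u`, producing the path `ρ` with path `l` of reduced states, are time-optimal for
cooling. The comparison is with all solutions `σ` of the full control system, for arbitrary
admissible controls and an arbitrary duration `T`, which start with the eigenvalues that the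
path `ρ` has at some time `s ≥ 0`. -/
structure IsTimeOptimalCooling (ν : ℝ) (u : Controls) (ρ : ℝ → Mat2) (l : ℝ → ℝ) : Prop where
  solution : IsSolution ν (Ici 0) u ρ
  reduced : IsReducedPath (Ici 0) ρ l
  /-- The path converges to a pure state. -/
  cools : Tendsto l atTop (𝓝 1)
  /-- No competitor has a larger reduced state after the same amount of time. -/
  max_value : ∀ s, 0 ≤ s → ∀ T, 0 ≤ T → ∀ (v : Controls) (σ : ℝ → Mat2) (m : ℝ → ℝ),
    IsSolution ν (Icc 0 T) v σ → IsReducedPath (Icc 0 T) σ m → m 0 = l s → m T ≤ l (s + T)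
  /-- No competitor reaches a reduced state of the path `l` in a shorter time. -/
  min_time : ∀ s, 0 ≤ s → ∀ t, s ≤ t → ∀ T, 0 ≤ T →
    ∀ (v : Controls) (σ : ℝ → Mat2) (m : ℝ → ℝ),
    IsSolution ν (Icc 0 T) v σ → IsReducedPath (Icc 0 T) σ m → m 0 = l s → m T = l t → t - s ≤ T
  /-- Once the larger eigenvalue is the one followed by `l`, the path is optimal for every
  Schur-convex measure of coolness. -/
  max_measure : ∀ s, 0 ≤ s → 1 / 2 ≤ l s → ∀ T, 0 ≤ T → ∀ (v : Controls) (σ : ℝ → Mat2),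
    IsSolution ν (Icc 0 T) v σ → HasReducedState (σ 0) (l s) →
    ∀ m, HasReducedState (σ T) m →
    ∀ f, SchurConvex f → f ![m, 1 - m] ≤ f ![l (s + T), 1 - l (s + T)]

/-! ### The optimal path and the optimal controls -/

/-- The time `t₀`, the solution of `exp (-(1+ν²) t₀) = 1 - (1+ν²)/(1+ν)`; it is infinite if
`ν = 0`. -/
def switchTime (ν : ℝ) : EReal :=
  if ν = 0 then ⊤ else ((-Real.log (1 - (1 + ν ^ 2) / (1 + ν)) / (1 + ν ^ 2) : ℝ) : EReal)

/-- The constant `c` in the optimal path, for `0 < ν < 1`. -/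
def pathConst (ν : ℝ) : ℝ :=
  4 * ν / (1 + ν) ^ 2 * ((1 + ν) / (ν * (1 - ν))) ^ ((1 - ν) ^ 2 / (1 + ν ^ 2))

open Classical in
/-- The optimal reduced path `λ*`. -/
def lamStar (ν t : ℝ) : ℝ :=
  if (t : EReal) ≤ switchTime ν then (1 - Real.exp (-(1 + ν ^ 2) * t)) / (1 + ν ^ 2)
  else (1 + Real.sqrt (1 - pathConst ν * Real.exp (-(1 - ν) ^ 2 * t))) / 2

open Classical in
/-- The angle function `y*`. -/
def yStar (ν t : ℝ) : ℝ :=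
  if (t : EReal) ≤ switchTime ν then 0
  else 1 / Real.pi *
    Real.arcsin (Real.sqrt (1 / 2 * (1 + (1 - ν) / (1 + ν) * (1 / (1 - 2 * lamStar ν t)))))

/-- The unitary `exp(i π θ σ_y)`. -/
def rotY (θ : ℝ) : Mat2 := NormedSpace.exp ((Complex.I * (Real.pi * θ : ℝ)) • σy)

/-- The path `Ad_U(diag(λ*, 1 - λ*))` with `U = exp(-ε i π y* σ_y)`, for a sign `ε = ±1`. -/
def rhoStar (ε ν t : ℝ) : Mat2 :=
  rotY (-ε * yStar ν t) * diagState (lamStar ν t) * (rotY (-ε * yStar ν t)).conjTranspose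

/-- The direct term of the control, as a function of `l = λ*(t)`. -/
def directTerm (ν l : ℝ) : ℝ :=
  (1 / (2 * l - 1) * ((1 - ν) / (1 + ν))) /
      Real.sqrt ((2 * l - 1) ^ 2 - ((1 - ν) / (1 + ν)) ^ 2) *
    (((1 - ν) / 2) ^ 2 * (1 / (2 * l - 1) - (2 * l - 1)))

/-- The compensating term of the control, as a function of `l = λ*(t)` and `y = y*(t)`. -/
def compensatingTerm (ν l y : ℝ) : ℝ :=
  (1 + ν) * Real.sin (2 * Real.pi * y) / 4 *
    (2 * (1 - ν) / (2 * l - 1) - (1 + ν) * Real.cos (2 * Real.pi * y))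

open Classical in
/-- The optimal controls: `u_x = u_z = 0`, and `u_y` vanishes up to `t₀` and is afterwards `ε` times
the sum of the direct and the compensating term. -/
def optimalControls (ε ν : ℝ) : Controls where
  x := fun _ => 0
  y := fun t => if (t : EReal) ≤ switchTime ν then 0
    else ε * (directTerm ν (lamStar ν t) + compensatingTerm ν (lamStar ν t) (yStar ν t))
  z := fun _ => 0

end QubitCooling

end

/-! In Bloch coordinates (x, y, z) the controls only rotate the Bloch vector, so they drop out of
the derivative of its squared length Q: Q' = 2G with G = -(1-ν)²x²/2 - (1+ν)²y²/2 + (1-ν²)z -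
(1+ν²)z². A reduced path λ is the same as a signed length m = 2λ - 1 with m² = Q, so m' = G/m
wherever m ≠ 0. Maximising G/m over the sphere of radius |m| (`sq_growth_bound`) gives
`coolingRate`, attained at y = 0 and height z = min(m, (1-ν)/(1+ν)): the best state lies on the axis
until the critical height and then stays in the horizontal plane at that height.

The length `lenStar` of the candidate solves n' = `coolingRate` n except at the switching time.
Since the rate is antitone, a competitor that has overtaken n cannot increase its lead, which is
`IsSolution.signedLength_le`. The delicate point is that m may change sign and need not be
differentiable at its zeros; `comparison` bypasses the zeros using that n is nondecreasing.

For attainability, `rhoStar` has Bloch vector (ε·`blochX`, 0, `blochZ`), and the prescribed control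
simplifies to ε ν z/X with X = `blochX` and z the critical height (`control_eq`). This is the value
that holds the height constant. It is singular at the switching time but integrable, being a
combination of X and the derivative of the monotone function X. -/

/-! ### Absolutely continuous functions -/

/-- A function whose increments are dominated by those of an absolutely continuous function is
absolutely continuous. -/
theorem AbsolutelyContinuousOnInterval.of_dist_le {X Y : Type*} [PseudoMetricSpace X]
    [PseudoMetricSpace Y] {f : ℝ → X} {g : ℝ → Y} {a b : ℝ} (K : ℝ)
    (hf : AbsolutelyContinuousOnInterval f a b)
    (h : ∀ s ∈ uIcc a b, ∀ t ∈ uIcc a b, dist (g s) (g t) ≤ K * dist (f s) (f t)) :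
    AbsolutelyContinuousOnInterval g a b := by
  unfold AbsolutelyContinuousOnInterval at hf ⊢
  refine squeeze_zero' (Eventually.of_forall fun E => Finset.sum_nonneg fun i _ => dist_nonneg)
    ?_ (by simpa using hf.const_mul K)
  filter_upwards [inf_le_right (a := AbsolutelyContinuousOnInterval.totalLengthFilter)
    (mem_principal_self (AbsolutelyContinuousOnInterval.disjWithin a b))] with E hE
  rw [Finset.mul_sum]
  exact Finset.sum_le_sum fun i hi => h _ (hE.1 i hi).1 _ (hE.1 i hi).2

/-- A continuous monotone function which is differentiable off a countable set is absolutely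
continuous. -/
theorem MonotoneOn.absolutelyContinuousOnInterval {f : ℝ → ℝ} {a b : ℝ}
    (hm : MonotoneOn f (uIcc a b)) (hc : ContinuousOn f (uIcc a b)) {s : Set ℝ} (hs : s.Countable)
    (hd : ∀ x ∈ uIcc a b \ s, DifferentiableAt ℝ f x) :
    AbsolutelyContinuousOnInterval f a b := by
  have hi : IntervalIntegrable (deriv f) volume a b := hm.intervalIntegrable_deriv
  -- Monotonicity makes the derivative integrable without any bound on it, so the function is the
  -- integral of its derivative even if the slope blows up at an exceptional point.
  refine (hi.absolutelyContinuousOnInterval_intervalIntegral left_mem_uIcc).of_dist_le 1 ?_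
  have key : ∀ x ∈ uIcc a b, ∫ v in a..x, deriv f v = f x - f a := by
    intro x hx
    have hsub : uIcc a x ⊆ uIcc a b := uIcc_subset_uIcc left_mem_uIcc hx
    refine integral_eq_of_hasDerivAt_off_countable f (deriv f) hs (hc.mono hsub) ?_
      (hi.mono_set hsub)
    rintro y ⟨hy, hys⟩
    exact (hd y ⟨hsub (Ioo_subset_Icc_self hy), hys⟩).hasDerivAt
  intro x hx y hy
  rw [key x hx, key y hy, one_mul, Real.dist_eq, Real.dist_eq]
  simp

/-- An absolutely continuous function with almost everywhere nonpositive derivative does not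
increase. -/
theorem AbsolutelyContinuousOnInterval.le_of_ae_deriv_nonpos {f : ℝ → ℝ} {a b : ℝ} (hab : a ≤ b)
    (hf : AbsolutelyContinuousOnInterval f a b) (h : ∀ᵐ t, t ∈ Ioo a b → deriv f t ≤ 0) :
    f b ≤ f a := by
  have h1 := hf.integral_deriv_eq_sub
  have h2 : ∫ t in a..b, deriv f t ≤ 0 := by
    rw [intervalIntegral.integral_of_le hab, integral_Ioc_eq_integral_Ioo]
    refine integral_nonpos_of_ae ?_
    rw [EventuallyLE, ae_restrict_iff' measurableSet_Ioo]
    exact h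
  linarith

/-- Continuity carries the inequality to the endpoints. This is needed because the signed length may
vanish exactly there. -/
theorem le_of_antitone_Ioo {f : ℝ → ℝ} {a b : ℝ} (hab : a ≤ b) (hf : ContinuousOn f (Icc a b))
    (h : ∀ x y, a < x → x ≤ y → y < b → f y ≤ f x) : f b ≤ f a := by
  rcases hab.eq_or_lt with rfl | hab
  · exact le_rfl
  have hb : ∀ x ∈ Ioo a b, f b ≤ f x := by
    intro x hx
    have ht : Tendsto f (𝓝[Ioo x b] b) (𝓝 (f b)) :=
      (hf b (right_mem_Icc.2 hab.le)).mono_left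
        (nhdsWithin_mono _ fun y hy => ⟨(hx.1.trans hy.1).le, hy.2.le⟩)
    have : (𝓝[Ioo x b] b).NeBot := right_nhdsWithin_Ioo_neBot hx.2
    refine le_of_tendsto ht ?_
    filter_upwards [self_mem_nhdsWithin] with y hy
    exact h x y hx.1 hy.1.le hy.2
  have ht : Tendsto f (𝓝[Ioo a b] a) (𝓝 (f a)) :=
    (hf a (left_mem_Icc.2 hab.le)).mono_left (nhdsWithin_mono _ Ioo_subset_Icc_self)
  have : (𝓝[Ioo a b] a).NeBot := left_nhdsWithin_Ioo_neBot hab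
  refine ge_of_tendsto ht ?_
  filter_upwards [self_mem_nhdsWithin] with y hy
  exact hb y hy

/-! ### Comparison for continuous square roots -/

/-- A continuous square root without zeros of an absolutely continuous function is absolutely
continuous. -/
theorem AbsolutelyContinuousOnInterval.of_sq {m Q : ℝ → ℝ} {a b : ℝ}
    (hm : ContinuousOn m (uIcc a b)) (hQ : AbsolutelyContinuousOnInterval Q a b)
    (hmQ : ∀ t ∈ uIcc a b, m t ^ 2 = Q t) (h0 : ∀ t ∈ uIcc a b, m t ≠ 0) :
    AbsolutelyContinuousOnInterval m a b := by
  obtain ⟨c, hc, hmin⟩ := isCompact_uIcc.exists_isMinOn nonempty_uIcc hm.abs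
  have hcpos : 0 < |m c| := abs_pos.2 (h0 c hc)
  refine hQ.of_dist_le (2 * |m c|)⁻¹ fun s hs t ht => ?_
  rw [Real.dist_eq, Real.dist_eq, ← hmQ s hs, ← hmQ t ht, inv_mul_eq_div, le_div_iff₀ (by positivity),
    sq_sub_sq, abs_mul, mul_comm]
  refine mul_le_mul_of_nonneg_right ?_ (abs_nonneg _)
  have hsm : |m c| ≤ |m s| := hmin hs
  have htm : |m c| ≤ |m t| := hmin ht
  -- A continuous function without zeros keeps its sign, so |m s + m t| = |m s| + |m t| ≥ 2 min |m|,
  -- which bounds the divisor in m s - m t = (Q s - Q t) / (m s + m t).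
  have hsign : 0 < m s * m t := by
    by_contra hle
    have hconn : IsPreconnected (m '' uIcc a b) := isPreconnected_uIcc.image m hm
    have hz : (0 : ℝ) ∈ m '' uIcc a b := by
      rcases lt_or_gt_of_ne (h0 s hs) with hs0 | hs0 <;> rcases lt_or_gt_of_ne (h0 t ht) with ht0 | ht0
      · exact absurd (mul_pos_of_neg_of_neg hs0 ht0) hle
      · exact hconn.ordConnected.out (mem_image_of_mem m hs) (mem_image_of_mem m ht)
          ⟨hs0.le, ht0.le⟩
      · exact hconn.ordConnected.out (mem_image_of_mem m ht) (mem_image_of_mem m hs)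
          ⟨ht0.le, hs0.le⟩
      · exact absurd (mul_pos hs0 ht0) hle
    obtain ⟨t, ht, h⟩ := hz
    exact h0 t ht h
  rw [abs_add_eq_add_abs_iff _ _ |>.2 (by
    rcases pos_and_pos_or_neg_and_neg_of_mul_pos hsign with h | h
    · exact Or.inl ⟨h.1.le, h.2.le⟩
    · exact Or.inr ⟨h.1.le, h.2.le⟩)]
  linarith

/-- Without zeros m is absolutely continuous, and Q' = 2mm' turns the hypothesis into m' ≤ n' after
division by m². The factor m² avoids a case distinction on the sign of m. -/
theorem comparison_of_ne_zero {m n Q : ℝ → ℝ} {a b : ℝ} (hab : a ≤ b)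
    (hm : ContinuousOn m (Icc a b)) (hQ : AbsolutelyContinuousOnInterval Q a b)
    (hn : AbsolutelyContinuousOnInterval n a b)
    (hmQ : ∀ t ∈ Icc a b, m t ^ 2 = Q t) (h0 : ∀ t ∈ Icc a b, m t ≠ 0)
    (hd : ∀ᵐ t, t ∈ Ioo a b → deriv Q t * m t ≤ 2 * m t ^ 2 * deriv n t) :
    m b - n b ≤ m a - n a := by
  rw [← uIcc_of_le hab] at hm hmQ h0
  have hmac := AbsolutelyContinuousOnInterval.of_sq hm hQ hmQ h0
  refine (hmac.sub hn).le_of_ae_deriv_nonpos (f := m - n) hab ?_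
  filter_upwards [hd, hmac.ae_differentiableAt, hn.ae_differentiableAt] with t h1 h2 h3 ht
  have htu : t ∈ uIcc a b := by rw [uIcc_of_le hab]; exact Ioo_subset_Icc_self ht
  have hev : Q =ᶠ[𝓝 t] fun s => m s ^ 2 := by
    filter_upwards [isOpen_Ioo.mem_nhds ht] with s hs
    exact (hmQ s (by rw [uIcc_of_le hab]; exact Ioo_subset_Icc_self hs)).symm
  have hQd : deriv Q t = 2 * m t * deriv m t := by
    rw [hev.deriv_eq]
    have := ((h2 htu).hasDerivAt.fun_pow 2).deriv
    simpa using this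
  have h4 := h1 ht
  rw [hQd] at h4
  rw [deriv_sub (h2 htu) (h3 htu)]
  have hpos : 0 < m t ^ 2 := by have := h0 t htu; positivity
  have : m t ^ 2 * (deriv m t - deriv n t) ≤ 0 := by nlinarith
  nlinarith

/-- Comparison of a continuous square root `m` of an absolutely continuous function `Q` with a
nondecreasing absolutely continuous function `n`. Only the times with `n < m` matter, and `m` may
change its sign. -/
theorem comparison {m n Q : ℝ → ℝ} {T : ℝ} (hT : 0 ≤ T)
    (hm : ContinuousOn m (Icc 0 T)) (hQ : AbsolutelyContinuousOnInterval Q 0 T)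
    (hn : AbsolutelyContinuousOnInterval n 0 T) (hmono : MonotoneOn n (Icc 0 T))
    (hmQ : ∀ t ∈ Icc 0 T, m t ^ 2 = Q t)
    (hd : ∀ᵐ t, t ∈ Ioo 0 T → n t ≤ m t → deriv Q t * m t ≤ 2 * m t ^ 2 * deriv n t)
    (hinit : m 0 ≤ n 0) : m T ≤ n T := by
  by_contra! hlt
  have hnc : ContinuousOn n (Icc 0 T) := by simpa [uIcc_of_le hT] using hn.continuousOn
  have hK : IsCompact {t ∈ Icc 0 T | m t ≤ n t} :=
    isCompact_Icc.of_isClosed_subset (isClosed_Icc.isClosed_le hm hnc) (sep_subset _ _)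
  -- The last time at which m has not overtaken n; afterwards the derivative hypothesis applies
  -- throughout.
  obtain ⟨τ, ⟨hτ, hτle⟩, hτmax⟩ := hK.exists_isGreatest ⟨0, left_mem_Icc.2 hT, hinit⟩
  have hgt : ∀ t, τ < t → t ≤ T → n t < m t := by
    intro t h1 h2
    by_contra! h3
    exact absurd (hτmax ⟨⟨hτ.1.trans h1.le, h2⟩, h3⟩) (not_le.2 h1)
  have hA : ∀ a b, τ ≤ a → a ≤ b → b ≤ T → (∀ t ∈ Ioo a b, m t ≠ 0) →
      m b - n b ≤ m a - n a := by
    intro a b h1 h2 h3 h0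
    have hsub : Icc a b ⊆ Icc 0 T := Icc_subset_Icc (hτ.1.trans h1) h3
    refine le_of_antitone_Ioo (f := fun t => m t - n t) h2 ((hm.sub hnc).mono hsub) ?_
    intro x y hx hxy hy
    have hsub' : Icc x y ⊆ Icc 0 T := (Icc_subset_Icc hx.le hy.le).trans hsub
    have hsubu : uIcc x y ⊆ uIcc 0 T := by rwa [uIcc_of_le hxy, uIcc_of_le hT]
    refine comparison_of_ne_zero hxy (hm.mono hsub') (hQ.mono hsubu) (hn.mono hsubu)
      (fun t ht => hmQ t (hsub' ht)) (fun t ht => h0 t ⟨hx.trans_le ht.1, ht.2.trans_lt hy⟩) ?_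
    filter_upwards [hd] with t ht hxt
    have h4 : τ < t := h1.trans_lt (hx.trans hxt.1)
    have h5 : t < T := hxt.2.trans (hy.trans_le h3)
    exact ht ⟨hτ.1.trans_lt h4, h5⟩ (hgt t h4 h5.le).le
  have hsubτ : Icc τ T ⊆ Icc 0 T := Icc_subset_Icc hτ.1 le_rfl
  suffices m T - n T ≤ m τ - n τ by linarith
  -- Between the first zero c and the last zero d nothing is needed about m: it vanishes at both
  -- ends, while n c ≤ n d, so m - n does not increase from c to d.
  by_cases hz : ∃ t ∈ Icc τ T, m t = 0
  · have hZ : IsCompact {t ∈ Icc τ T | m t = 0} := by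
      have := (hm.mono hsubτ).preimage_isClosed_of_isClosed isClosed_Icc
        (isClosed_singleton (x := (0 : ℝ)))
      exact isCompact_Icc.of_isClosed_subset this (sep_subset _ _)
    obtain ⟨t, ht, ht0⟩ := hz
    obtain ⟨c, ⟨hc, hc0⟩, hcmin⟩ := hZ.exists_isLeast ⟨t, ht, ht0⟩
    obtain ⟨d, ⟨hdd, hd0⟩, hdmax⟩ := hZ.exists_isGreatest ⟨t, ht, ht0⟩
    have h1 := hA τ c le_rfl hc.1 hc.2 fun t ht h =>
      absurd (hcmin ⟨⟨ht.1.le, ht.2.le.trans hc.2⟩, h⟩) (not_le.2 ht.2)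
    have h2 := hA d T hdd.1 hdd.2 le_rfl fun t ht h =>
      absurd (hdmax ⟨⟨hdd.1.trans ht.1.le, ht.2.le⟩, h⟩) (not_le.2 ht.1)
    have h3 : n c ≤ n d := hmono (hsubτ hc) (hsubτ hdd) (hcmin ⟨hdd, hd0⟩)
    linarith
  · push Not at hz
    exact hA τ T le_rfl hτ.2 le_rfl fun t ht => hz t (Ioo_subset_Icc_self ht)

noncomputable section

namespace QubitCooling

/-! ### The optimal signed Bloch length -/

/-- The height `(1 - ν) / (1 + ν)` in the Bloch ball at which the optimal path leaves the axis. -/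
def critHeight (ν : ℝ) : ℝ := (1 - ν) / (1 + ν)

/-- The largest rate at which the signed Bloch length `m` can grow. -/
def coolingRate (ν m : ℝ) : ℝ :=
  if m ≤ critHeight ν then (1 - ν ^ 2) - (1 + ν ^ 2) * m else (1 - ν) ^ 2 / 2 * (1 / m - m)

/-- The signed Bloch length of `lamStar`. -/
def lenStar (ν t : ℝ) : ℝ := 2 * lamStar ν t - 1

/-- The signed Bloch length on the axis, before the switching time. -/
def axisLen (ν t : ℝ) : ℝ := 2 * ((1 - Real.exp (-(1 + ν ^ 2) * t)) / (1 + ν ^ 2)) - 1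

/-- The signed Bloch length after the switching time. -/
def planeLen (ν t : ℝ) : ℝ := Real.sqrt (1 - pathConst ν * Real.exp (-(1 - ν) ^ 2 * t))

/-- The switching time as a real number, for `0 < ν`. -/
def realSwitchTime (ν : ℝ) : ℝ := -Real.log (1 - (1 + ν ^ 2) / (1 + ν)) / (1 + ν ^ 2)

/-! ### The cooling rate and the phase on the axis -/

section CritHeight

variable {ν : ℝ}

theorem critHeight_pos (h0 : 0 ≤ ν) (h1 : ν < 1) : 0 < critHeight ν :=
  div_pos (by linarith) (by linarith)

theorem critHeight_le_one (h0 : 0 ≤ ν) : critHeight ν ≤ 1 := by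
  rw [critHeight, div_le_one (by linarith)]; linarith

theorem critHeight_mul (h0 : 0 ≤ ν) : (1 + ν) * critHeight ν = 1 - ν := by
  rw [critHeight]; field_simp

theorem one_sub_critHeight_sq (h0 : 0 ≤ ν) :
    (1 + ν) ^ 2 * (1 - critHeight ν ^ 2) = 4 * ν := by
  have := critHeight_mul h0
  linear_combination (-(1 + ν) * critHeight ν - (1 - ν)) * this

theorem coolingRate_antitone (h0 : 0 ≤ ν) (h1 : ν < 1) : Antitone (coolingRate ν) := by
  intro a b hab
  have hz := critHeight_pos h0 h1
  have hm := critHeight_mul h0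
  have hlin : ∀ x y : ℝ, x ≤ y →
      (1 - ν ^ 2) - (1 + ν ^ 2) * y ≤ (1 - ν ^ 2) - (1 + ν ^ 2) * x := by
    intro x y h; nlinarith [sq_nonneg ν]
  have hinv : ∀ x y : ℝ, 0 < x → x ≤ y →
      (1 - ν) ^ 2 / 2 * (1 / y - y) ≤ (1 - ν) ^ 2 / 2 * (1 / x - x) := by
    intro x y hx h
    have := one_div_le_one_div_of_le hx h
    exact mul_le_mul_of_nonneg_left (by linarith) (by positivity)
  unfold coolingRate
  split_ifs with hb ha ha
  · exact hlin a b hab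
  · exact absurd (hab.trans hb) ha
  -- The two branches agree at the critical height, so each comparison is made through that point.
  · refine (hinv _ b hz (not_le.1 hb).le).trans (le_trans (le_of_eq ?_) (hlin a _ ha))
    rw [critHeight]
    have : (1 - ν) ≠ 0 := by linarith
    field_simp
    ring
  · exact hinv a b (hz.trans (not_le.1 ha)) hab

theorem axisLen_hasDerivAt (ν t : ℝ) :
    HasDerivAt (axisLen ν) ((1 - ν ^ 2) - (1 + ν ^ 2) * axisLen ν t) t := by
  have h : (1 + ν ^ 2) ≠ 0 := by positivity
  have h1 : HasDerivAt (fun t => -(1 + ν ^ 2) * t) (-(1 + ν ^ 2)) t := 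
    ((hasDerivAt_id t).const_mul _).congr_deriv (mul_one _)
  have h2 := (((h1.exp.const_sub 1).div_const (1 + ν ^ 2)).const_mul 2).sub_const 1
  refine h2.congr_deriv ?_
  rw [axisLen]
  field_simp
  ring

theorem axisLen_strictMono (ν : ℝ) : StrictMono (axisLen ν) := by
  intro s t h
  have hp : (0 : ℝ) < 1 + ν ^ 2 := by positivity
  have : Real.exp (-(1 + ν ^ 2) * t) < Real.exp (-(1 + ν ^ 2) * s) :=
    Real.exp_lt_exp.2 (by nlinarith)
  unfold axisLen
  gcongr

theorem axisLen_continuous (ν : ℝ) : Continuous (axisLen ν) :=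
  continuous_iff_continuousAt.2 fun t => (axisLen_hasDerivAt ν t).continuousAt

end CritHeight

/-! ### The switching time and the phase in the plane -/

section SwitchTime

variable {ν : ℝ}

theorem exp_realSwitchTime (h0 : 0 < ν) (h1 : ν < 1) :
    Real.exp (-(1 + ν ^ 2) * realSwitchTime ν) = ν * (1 - ν) / (1 + ν) := by
  have hp : (1 + ν ^ 2) ≠ 0 := by positivity
  have h : 1 - (1 + ν ^ 2) / (1 + ν) = ν * (1 - ν) / (1 + ν) := by
    field_simp; ring
  have hpos : 0 < ν * (1 - ν) / (1 + ν) :=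
    div_pos (mul_pos h0 (by linarith)) (by linarith)
  have h2 : -(1 + ν ^ 2) * realSwitchTime ν = Real.log (ν * (1 - ν) / (1 + ν)) := by
    rw [realSwitchTime, h]; field_simp
  rw [h2, Real.exp_log hpos]

theorem realSwitchTime_pos (h0 : 0 < ν) (h1 : ν < 1) : 0 < realSwitchTime ν := by
  have h := exp_realSwitchTime h0 h1
  have h2 : Real.exp (-(1 + ν ^ 2) * realSwitchTime ν) < 1 := by
    rw [h, div_lt_one (by linarith)]; nlinarith
  rw [Real.exp_lt_one_iff] at h2
  nlinarith [sq_nonneg ν]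

theorem switchTime_of_pos (h0 : 0 < ν) : switchTime ν = (realSwitchTime ν : EReal) := by
  rw [switchTime, if_neg h0.ne', realSwitchTime]

theorem axisLen_realSwitchTime (h0 : 0 < ν) (h1 : ν < 1) :
    axisLen ν (realSwitchTime ν) = critHeight ν := by
  rw [axisLen, exp_realSwitchTime h0 h1, critHeight]
  field_simp
  ring

/-- The constant c is what makes the two phases match: 1 - n² decays at rate (1-ν)² from its value 1
- `critHeight ν`² at the switching time. -/
theorem pathConst_mul_exp (h0 : 0 < ν) (h1 : ν < 1) (t : ℝ) :
    pathConst ν * Real.exp (-(1 - ν) ^ 2 * t) =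
      (1 - critHeight ν ^ 2) * Real.exp (-(1 - ν) ^ 2 * (t - realSwitchTime ν)) := by
  have hpos : 0 < ν * (1 - ν) / (1 + ν) :=
    div_pos (mul_pos h0 (by linarith)) (by linarith)
  have hp : (1 + ν ^ 2) ≠ 0 := by positivity
  have h2 : Real.exp (-(1 - ν) ^ 2 * realSwitchTime ν) =
      (ν * (1 - ν) / (1 + ν)) ^ ((1 - ν) ^ 2 / (1 + ν ^ 2)) := by
    rw [← exp_realSwitchTime h0 h1, ← Real.exp_mul]
    congr 1
    field_simp
  have h3 : ((1 + ν) / (ν * (1 - ν))) ^ ((1 - ν) ^ 2 / (1 + ν ^ 2)) =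
      (Real.exp (-(1 - ν) ^ 2 * realSwitchTime ν))⁻¹ := by
    rw [h2, ← Real.inv_rpow hpos.le, inv_div]
  have h4 : 1 - critHeight ν ^ 2 = 4 * ν / (1 + ν) ^ 2 := by
    rw [eq_div_iff (by positivity), mul_comm, one_sub_critHeight_sq h0.le]
  rw [pathConst, h3, h4, mul_assoc, ← Real.exp_neg, ← Real.exp_add]
  congr 2
  ring

theorem planeLen_eq (h0 : 0 < ν) (h1 : ν < 1) (t : ℝ) :
    planeLen ν t =
      Real.sqrt (1 - (1 - critHeight ν ^ 2) * Real.exp (-(1 - ν) ^ 2 * (t - realSwitchTime ν))) := by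
  rw [planeLen, pathConst_mul_exp h0 h1]

theorem planeLen_realSwitchTime (h0 : 0 < ν) (h1 : ν < 1) :
    planeLen ν (realSwitchTime ν) = critHeight ν := by
  rw [planeLen_eq h0 h1]
  simp [Real.sqrt_sq (critHeight_pos h0.le h1).le]

theorem one_sub_critHeight_sq_pos (h0 : 0 < ν) : 0 < 1 - critHeight ν ^ 2 := by
  have := one_sub_critHeight_sq h0.le
  have h2 : 0 < (1 + ν) ^ 2 * (1 - critHeight ν ^ 2) := by rw [this]; linarith
  exact pos_of_mul_pos_right h2 (by positivity)

theorem planeLen_radicand_pos (h0 : 0 < ν) (h1 : ν < 1) {t : ℝ} (ht : realSwitchTime ν ≤ t) :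
    0 < 1 - (1 - critHeight ν ^ 2) * Real.exp (-(1 - ν) ^ 2 * (t - realSwitchTime ν)) := by
  have h := one_sub_critHeight_sq_pos h0
  have hz := critHeight_pos h0.le h1
  have : Real.exp (-(1 - ν) ^ 2 * (t - realSwitchTime ν)) ≤ 1 := by
    rw [Real.exp_le_one_iff]; nlinarith [sq_nonneg (1 - ν)]
  nlinarith

theorem planeLen_strictMonoOn (h0 : 0 < ν) (h1 : ν < 1) :
    StrictMonoOn (planeLen ν) (Ici (realSwitchTime ν)) := by
  intro s hs t ht hst
  rw [planeLen_eq h0 h1, planeLen_eq h0 h1]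
  refine Real.sqrt_lt_sqrt (planeLen_radicand_pos h0 h1 hs).le ?_
  have h := one_sub_critHeight_sq_pos h0
  have hk : 0 < (1 - ν) ^ 2 := by have : 0 < 1 - ν := by linarith
                                  positivity
  have : Real.exp (-(1 - ν) ^ 2 * (t - realSwitchTime ν)) <
      Real.exp (-(1 - ν) ^ 2 * (s - realSwitchTime ν)) := Real.exp_lt_exp.2 (by nlinarith)
  nlinarith

theorem planeLen_continuous (ν : ℝ) : Continuous (planeLen ν) := by
  unfold planeLen; fun_prop

theorem planeLen_lt_one (h0 : 0 < ν) (h1 : ν < 1) (t : ℝ) : planeLen ν t < 1 := by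
  rw [planeLen_eq h0 h1, Real.sqrt_lt' one_pos]
  have := mul_pos (one_sub_critHeight_sq_pos h0)
    (Real.exp_pos (-(1 - ν) ^ 2 * (t - realSwitchTime ν)))
  linarith

theorem planeLen_hasDerivAt (h0 : 0 < ν) (h1 : ν < 1) {t : ℝ} (ht : realSwitchTime ν ≤ t) :
    HasDerivAt (planeLen ν) ((1 - ν) ^ 2 / 2 * (1 / planeLen ν t - planeLen ν t)) t := by
  have hr := planeLen_radicand_pos h0 h1 ht
  rw [← pathConst_mul_exp h0 h1] at hr
  have hd : HasDerivAt (fun t => -(1 - ν) ^ 2 * t) (-(1 - ν) ^ 2) t := 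
    ((hasDerivAt_id t).const_mul _).congr_deriv (mul_one _)
  have h2 := ((hd.exp.const_mul (pathConst ν)).const_sub 1).sqrt hr.ne'
  refine h2.congr_deriv ?_
  rw [planeLen]
  set R := 1 - pathConst ν * Real.exp (-(1 - ν) ^ 2 * t) with hR
  have hs : 0 < Real.sqrt R := Real.sqrt_pos.2 hr
  have hsq : Real.sqrt R ^ 2 = R := Real.sq_sqrt hr.le
  field_simp
  rw [hsq, hR]
  ring_nf

end SwitchTime

/-! ### The glued path as a solution of the rate equation -/

section LenStar

variable {ν : ℝ}

theorem lenStar_of_le {t : ℝ} (ht : (t : EReal) ≤ switchTime ν) : lenStar ν t = axisLen ν t := by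
  rw [lenStar, lamStar, if_pos ht, axisLen]

theorem lenStar_of_gt {t : ℝ} (ht : switchTime ν < (t : EReal)) : lenStar ν t = planeLen ν t := by
  rw [lenStar, lamStar, if_neg (not_le.2 ht), planeLen]; ring

theorem pos_of_switchTime_lt (h0 : 0 ≤ ν) {t : ℝ} (ht : switchTime ν < (t : EReal)) : 0 < ν := by
  rcases h0.eq_or_lt with rfl | h
  · simp [switchTime] at ht
  · exact h

theorem realSwitchTime_lt (h0 : 0 ≤ ν) {t : ℝ} (ht : switchTime ν < (t : EReal)) :
    realSwitchTime ν < t := by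
  rw [switchTime_of_pos (pos_of_switchTime_lt h0 ht)] at ht
  exact_mod_cast ht

theorem zero_lt_switchTime (h0 : 0 ≤ ν) (h1 : ν < 1) : 0 < switchTime ν := by
  rcases h0.eq_or_lt with rfl | h
  · simp [switchTime]
  · rw [switchTime_of_pos h]; exact_mod_cast realSwitchTime_pos h h1

theorem lenStar_zero_param : lenStar 0 = axisLen 0 := by
  funext t
  exact lenStar_of_le (by simp [switchTime])

theorem lenStar_eqOn_Iic (h0 : 0 < ν) : EqOn (lenStar ν) (axisLen ν) (Iic (realSwitchTime ν)) := by
  intro t ht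
  refine lenStar_of_le ?_
  rw [switchTime_of_pos h0]; exact_mod_cast ht

theorem lenStar_eqOn_Ici (h0 : 0 < ν) (h1 : ν < 1) :
    EqOn (lenStar ν) (planeLen ν) (Ici (realSwitchTime ν)) := by
  intro t ht
  rcases (mem_Ici.1 ht).eq_or_lt with rfl | ht
  · rw [lenStar_eqOn_Iic h0 self_mem_Iic, axisLen_realSwitchTime h0 h1,
      planeLen_realSwitchTime h0 h1]
  · refine lenStar_of_gt ?_
    rw [switchTime_of_pos h0]; exact_mod_cast ht

theorem lenStar_strictMono (h0 : 0 ≤ ν) (h1 : ν < 1) : StrictMono (lenStar ν) := by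
  rcases h0.eq_or_lt with rfl | h
  · rw [lenStar_zero_param]; exact axisLen_strictMono 0
  · exact StrictMonoOn.Iic_union_Ici (a := realSwitchTime ν)
      (((axisLen_strictMono ν).strictMonoOn _).congr (lenStar_eqOn_Iic h).symm)
      ((planeLen_strictMonoOn h h1).congr (lenStar_eqOn_Ici h h1).symm)

theorem lenStar_continuous (h0 : 0 ≤ ν) (h1 : ν < 1) : Continuous (lenStar ν) := by
  rcases h0.eq_or_lt with rfl | h
  · rw [lenStar_zero_param]; exact axisLen_continuous 0
  · rw [← continuousOn_univ, ← Iic_union_Ici (a := realSwitchTime ν)]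
    exact ((axisLen_continuous ν).continuousOn.congr (lenStar_eqOn_Iic h)).union_of_isClosed
      ((planeLen_continuous ν).continuousOn.congr (lenStar_eqOn_Ici h h1)) isClosed_Iic isClosed_Ici

theorem lenStar_le_critHeight (h0 : 0 ≤ ν) (h1 : ν < 1) {t : ℝ} (ht : (t : EReal) ≤ switchTime ν) :
    lenStar ν t ≤ critHeight ν := by
  rcases h0.eq_or_lt with rfl | h
  · have := Real.exp_pos (-t)
    simp only [lenStar_zero_param, axisLen, critHeight]
    norm_num
    linarith
  · rw [lenStar_of_le ht, ← axisLen_realSwitchTime h h1, (axisLen_strictMono ν).le_iff_le]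
    rw [switchTime_of_pos h] at ht
    exact_mod_cast ht

theorem critHeight_lt_lenStar (h0 : 0 ≤ ν) (h1 : ν < 1) {t : ℝ} (ht : switchTime ν < (t : EReal)) :
    critHeight ν < lenStar ν t := by
  have h := pos_of_switchTime_lt h0 ht
  have ht' := realSwitchTime_lt h0 ht
  rw [lenStar_of_gt ht, ← planeLen_realSwitchTime h h1]
  exact planeLen_strictMonoOn h h1 self_mem_Ici ht'.le ht'

theorem lenStar_lt_one (h0 : 0 ≤ ν) (h1 : ν < 1) (t : ℝ) : lenStar ν t < 1 := by
  -- The weak bound at a later time suffices by strict monotonicity; for ν = 0 the critical height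
  -- is itself 1 and gives no strict bound.
  have key : ∀ t : ℝ, lenStar ν t ≤ 1 := by
    intro t
    rcases le_or_gt (t : EReal) (switchTime ν) with ht | ht
    · exact (lenStar_le_critHeight h0 h1 ht).trans (critHeight_le_one h0)
    · rw [lenStar_of_gt ht]; exact (planeLen_lt_one (pos_of_switchTime_lt h0 ht) h1 t).le
  exact (lenStar_strictMono h0 h1 (lt_add_one t)).trans_le (key _)

theorem lenStar_zero (h0 : 0 ≤ ν) (h1 : ν < 1) : lenStar ν 0 = -1 := by
  rw [lenStar_of_le (by simpa using (zero_lt_switchTime h0 h1).le)]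
  simp [axisLen]

theorem neg_one_le_lenStar (h0 : 0 ≤ ν) (h1 : ν < 1) {t : ℝ} (ht : 0 ≤ t) : -1 ≤ lenStar ν t := by
  rw [← lenStar_zero h0 h1]; exact (lenStar_strictMono h0 h1).monotone ht

/-- The single exceptional time, if any, as a set. -/
theorem countable_switch (ν : ℝ) : {t : ℝ | (t : EReal) = switchTime ν}.Countable :=
  Set.Subsingleton.countable fun s hs t ht => by
    have : (s : EReal) = t := Eq.trans hs (Eq.symm ht)
    exact_mod_cast this

theorem eventually_lt_switchTime {t : ℝ} (ht : (t : EReal) < switchTime ν) :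
    ∀ᶠ s in 𝓝 t, ((s : ℝ) : EReal) < switchTime ν :=
  (continuous_coe_real_ereal.tendsto t).eventually (gt_mem_nhds ht)

theorem eventually_switchTime_lt {t : ℝ} (ht : switchTime ν < (t : EReal)) :
    ∀ᶠ s in 𝓝 t, switchTime ν < ((s : ℝ) : EReal) :=
  (continuous_coe_real_ereal.tendsto t).eventually (lt_mem_nhds ht)

theorem lenStar_hasDerivAt (h0 : 0 ≤ ν) (h1 : ν < 1) {t : ℝ} (ht : (t : EReal) ≠ switchTime ν) :
    HasDerivAt (lenStar ν) (coolingRate ν (lenStar ν t)) t := by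
  rcases lt_or_gt_of_ne ht with ht | ht
  · rw [coolingRate, if_pos (lenStar_le_critHeight h0 h1 ht.le), lenStar_of_le ht.le]
    refine (axisLen_hasDerivAt ν t).congr_of_eventuallyEq ?_
    filter_upwards [eventually_lt_switchTime ht] with s hs
    exact lenStar_of_le hs.le
  · rw [coolingRate, if_neg (not_le.2 (critHeight_lt_lenStar h0 h1 ht)), lenStar_of_gt ht]
    refine (planeLen_hasDerivAt (pos_of_switchTime_lt h0 ht) h1
      (realSwitchTime_lt h0 ht).le).congr_of_eventuallyEq ?_
    filter_upwards [eventually_switchTime_lt ht] with s hs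
    exact lenStar_of_gt hs

theorem lenStar_tendsto (h0 : 0 ≤ ν) (h1 : ν < 1) : Tendsto (lenStar ν) atTop (𝓝 1) := by
  have hexp : ∀ k : ℝ, 0 < k → Tendsto (fun t : ℝ => Real.exp (-k * t)) atTop (𝓝 0) := by
    intro k hk
    exact Real.tendsto_exp_atBot.comp ((tendsto_const_mul_atBot_of_neg (by linarith)).2 tendsto_id)
  rcases h0.eq_or_lt with rfl | h
  · rw [lenStar_zero_param]
    have := (((hexp (1 + (0 : ℝ) ^ 2) (by norm_num)).const_sub 1).div_const
      (1 + (0 : ℝ) ^ 2)).const_mul 2 |>.sub_const 1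
    refine (this.congr fun t => rfl).trans (le_of_eq ?_)
    norm_num
  · have hk : 0 < (1 - ν) ^ 2 := by have : 0 < 1 - ν := by linarith
                                    positivity
    have := (((hexp _ hk).const_mul (pathConst ν)).const_sub 1).sqrt
    have h2 : Tendsto (planeLen ν) atTop (𝓝 1) := by
      unfold planeLen; simpa using this
    refine h2.congr' ?_
    filter_upwards [eventually_ge_atTop (realSwitchTime ν)] with t ht
    exact (lenStar_eqOn_Ici h h1 ht).symm

end LenStar

/-! ### Bloch coordinates and the purity bound for arbitrary controls -/

/-- The squared length of the Bloch vector. -/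
def blochSq (ρ : Mat2) : ℝ :=
  (2 * (ρ 0 0).re - 1) ^ 2 + (2 * (ρ 0 1).re) ^ 2 + (2 * (ρ 0 1).im) ^ 2

theorem IsDensity.entries {ρ : Mat2} (h : IsDensity ρ) :
    (ρ 0 0).im = 0 ∧ ρ 1 0 = star (ρ 0 1) ∧ ρ 1 1 = 1 - ρ 0 0 := by
  have hH := h.1.isHermitian
  refine ⟨?_, (hH.apply 1 0).symm, ?_⟩
  · have := congrArg Complex.im (hH.apply 0 0)
    simp only [Complex.star_def, Complex.conj_im] at this
    linarith
  · have := h.2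
    rw [Matrix.trace_fin_two] at this
    linear_combination this

theorem IsDensity.det_eq {ρ : Mat2} (h : IsDensity ρ) :
    ρ.det = (((1 - blochSq ρ) / 4 : ℝ) : ℂ) := by
  obtain ⟨h0, h1, h2⟩ := h.entries
  rw [Matrix.det_fin_two, h1, h2]
  apply Complex.ext
  · rw [Complex.ofReal_re]; simp [blochSq, h0]; ring
  · rw [Complex.ofReal_im]; simp [h0]; ring

theorem IsDensity.blochSq_le_one {ρ : Mat2} (h : IsDensity ρ) : blochSq ρ ≤ 1 := by
  have := h.1.det_nonneg
  rw [h.det_eq, Complex.zero_le_real] at this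
  linarith

theorem HasReducedState.det_eq {ρ : Mat2} {l : ℝ} (h : HasReducedState ρ l) :
    ρ.det = ((l * (1 - l) : ℝ) : ℂ) := by
  obtain ⟨U, hU, rfl⟩ := h
  have hd : U.det = 1 := (Matrix.mem_specialUnitaryGroup_iff.1 hU).2
  simp [diagState, Matrix.det_conjTranspose, hd]

theorem HasReducedState.sq_eq {ρ : Mat2} {l : ℝ} (hρ : IsDensity ρ) (h : HasReducedState ρ l) :
    (2 * l - 1) ^ 2 = blochSq ρ := by
  have := hρ.det_eq.symm.trans h.det_eq
  have : (1 - blochSq ρ) / 4 = l * (1 - l) := by exact_mod_cast this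
  linarith

theorem lindbladTerm_conjTranspose (ν : ℝ) :
    (lindbladTerm ν).conjTranspose = !![0, (ν : ℂ); 1, 0] := by
  ext i j; fin_cases i <;> fin_cases j <;> simp [lindbladTerm]

/-- The real coordinates of the controlled master equation. -/
theorem masterField_entries (ν : ℝ) (u : Controls) (t : ℝ) {ρ : Mat2} (h : IsDensity ρ) :
    (masterField ν u t ρ 0 0).re =
        -(2 * u.x t * (ρ 0 1).im) - 2 * u.y t * (ρ 0 1).re + (1 - (1 + ν ^ 2) * (ρ 0 0).re) ∧
    (masterField ν u t ρ 0 1).re =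
        2 * u.z t * (ρ 0 1).im + u.y t * (2 * (ρ 0 0).re - 1) - (1 - ν) ^ 2 / 2 * (ρ 0 1).re ∧
    (masterField ν u t ρ 0 1).im =
        -(2 * u.z t * (ρ 0 1).re) + u.x t * (2 * (ρ 0 0).re - 1) - (1 + ν) ^ 2 / 2 * (ρ 0 1).im := by
  obtain ⟨h0, h1, h2⟩ := h.entries
  have e : ρ = !![ρ 0 0, ρ 0 1; star (ρ 0 1), 1 - ρ 0 0] := by
    ext i j; fin_cases i <;> fin_cases j <;> simp [h1, h2]
  set a := ρ 0 0
  set b := ρ 0 1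
  rw [e]
  refine ⟨?_, ?_, ?_⟩ <;>
  · simp only [masterField, dissipator, lindbladTerm_conjTranspose]
    simp [lindbladTerm, Controls.hamiltonian, σx, σy, σz, Ring.lie_def,
      h0]
    ring


/-- The optimisation over the sphere of radius |m|. For m ≤ 0 the multiplication by m reverses the
inequality, so there the drift has to be bounded from below. -/
theorem sq_growth_bound {ν : ℝ} (h0 : 0 ≤ ν) (h1 : ν < 1) {m x y z : ℝ}
    (hm : m ^ 2 = z ^ 2 + x ^ 2 + y ^ 2) :
    (-(1 - ν) ^ 2 / 2 * x ^ 2 - (1 + ν) ^ 2 / 2 * y ^ 2 + (1 - ν ^ 2) * z - (1 + ν ^ 2) * z ^ 2) * m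
      ≤ m ^ 2 * coolingRate ν m := by
  have hz := critHeight_pos h0 h1
  have hc := critHeight_mul h0
  have hzm : z ^ 2 ≤ m ^ 2 := by nlinarith [sq_nonneg x, sq_nonneg y]
  have hzabs := sq_le_sq.1 hzm
  unfold coolingRate
  rcases le_or_gt m 0 with hneg | hpos
  · rw [if_pos (hneg.trans hz.le)]
    rw [abs_of_nonpos hneg] at hzabs
    have hz1 := (abs_le.1 hzabs).1
    have hz2 := (abs_le.1 hzabs).2
    have key : (1 - ν ^ 2) * m - (1 + ν ^ 2) * m ^ 2 ≤ -(1 - ν) ^ 2 / 2 * x ^ 2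
        - (1 + ν) ^ 2 / 2 * y ^ 2 + (1 - ν ^ 2) * z - (1 + ν ^ 2) * z ^ 2 := by
      have h3 : 0 ≤ (1 - ν ^ 2) * (z - m) := mul_nonneg (by nlinarith) (by linarith)
      have h4 : 0 ≤ (1 - ν) ^ 2 / 2 * (m ^ 2 - z ^ 2) := mul_nonneg (by positivity) (by linarith)
      have h5 : 0 ≤ ν * x ^ 2 := by positivity
      linear_combination h3 + h4 + 2 * h5 - (1 + ν) ^ 2 / 2 * hm
    nlinarith
  · rw [abs_of_pos hpos] at hzabs
    have hz2 := (abs_le.1 hzabs).2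
    split_ifs with hle
    · have key : -(1 - ν) ^ 2 / 2 * x ^ 2 - (1 + ν) ^ 2 / 2 * y ^ 2 + (1 - ν ^ 2) * z
          - (1 + ν ^ 2) * z ^ 2 ≤ (1 - ν ^ 2) * m - (1 + ν ^ 2) * m ^ 2 := by
        -- With y = 0 and x² = m² - z² the drift is a concave quadratic in z with vertex at the
        -- critical height, so below it the largest admissible z, namely m, is best.
        have h3 : 0 ≤ (m - z) * ((1 - ν ^ 2) - (1 + ν) ^ 2 / 2 * (m + z)) := by
          refine mul_nonneg (by linarith) ?_
          have h4 : (1 + ν) * m ≤ 1 - ν := by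
            rw [← hc]; exact mul_le_mul_of_nonneg_left hle (by linarith)
          nlinarith
        have h5 : 0 ≤ ν * y ^ 2 := by positivity
        linear_combination h3 + 2 * h5 + (1 - ν) ^ 2 / 2 * hm
      nlinarith
    · have key : -(1 - ν) ^ 2 / 2 * x ^ 2 - (1 + ν) ^ 2 / 2 * y ^ 2 + (1 - ν ^ 2) * z
          - (1 + ν ^ 2) * z ^ 2 ≤ (1 - ν) ^ 2 / 2 * (1 - m ^ 2) := by
        -- Completing the square, the deficit is ((1+ν)z - (1-ν))²/2 + 2νy².
        nlinarith [sq_nonneg ((1 + ν) * z - (1 - ν)), mul_nonneg h0 (sq_nonneg y)]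
      have e : m ^ 2 * ((1 - ν) ^ 2 / 2 * (1 / m - m)) = (1 - ν) ^ 2 / 2 * (1 - m ^ 2) * m := by
        field_simp
      rw [e]
      exact mul_le_mul_of_nonneg_right key hpos.le

/-- The Bloch length of a solution for arbitrary controls. -/
theorem IsSolution.blochSq_absolutelyContinuous {ν T : ℝ} (hT : 0 ≤ T) {v : Controls}
    {ρ : ℝ → Mat2} (h : IsSolution ν (Icc 0 T) v ρ) :
    AbsolutelyContinuousOnInterval (fun t => blochSq (ρ t)) 0 T := by
  have hac := h.absCont 0 (left_mem_Icc.2 hT) T (right_mem_Icc.2 hT)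
  have hre : ∀ i j, AbsolutelyContinuousOnInterval (fun t => (ρ t i j).re) 0 T := fun i j =>
    (hac i j).of_dist_le 1 fun s _ t _ => by
      rw [one_mul, Real.dist_eq, Complex.dist_eq, ← Complex.sub_re]
      exact Complex.abs_re_le_norm _
  have him : ∀ i j, AbsolutelyContinuousOnInterval (fun t => (ρ t i j).im) 0 T := fun i j =>
    (hac i j).of_dist_le 1 fun s _ t _ => by
      rw [one_mul, Real.dist_eq, Complex.dist_eq, ← Complex.sub_im]
      exact Complex.abs_im_le_norm _
  have hz : AbsolutelyContinuousOnInterval (fun t => 2 * (ρ t 0 0).re - 1) 0 T :=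
    ((hre 0 0).const_mul 2).of_dist_le 1 fun s _ t _ => by
      simp [Real.dist_eq]
  have hx := (hre 0 1).const_mul 2
  have hy := (him 0 1).const_mul 2
  have := ((hz.fun_mul hz).fun_add (hx.fun_mul hx)).fun_add (hy.fun_mul hy)
  simpa only [blochSq, sq] using this

/-- The Hamiltonian part is an infinitesimal rotation of the Bloch vector, orthogonal to it, hence
the controls cancel. -/
theorem blochSq_hasDerivAt {ν t : ℝ} {v : Controls} {ρ : ℝ → Mat2} (hρ : IsDensity (ρ t))
    (hd : ∀ i j, HasDerivAt (fun s => ρ s i j) (masterField ν v t (ρ t) i j) t) :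
    HasDerivAt (fun t => blochSq (ρ t))
      (2 * (-(1 - ν) ^ 2 / 2 * (2 * (ρ t 0 1).re) ^ 2 - (1 + ν) ^ 2 / 2 * (2 * (ρ t 0 1).im) ^ 2
        + (1 - ν ^ 2) * (2 * (ρ t 0 0).re - 1) - (1 + ν ^ 2) * (2 * (ρ t 0 0).re - 1) ^ 2)) t := by
  obtain ⟨e1, e2, e3⟩ := masterField_entries ν v t hρ
  have hre : ∀ i j, HasDerivAt (fun s => (ρ s i j).re) (masterField ν v t (ρ t) i j).re t :=
    fun i j => Complex.reCLM.hasFDerivAt.comp_hasDerivAt t (hd i j)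
  have him : ∀ i j, HasDerivAt (fun s => (ρ s i j).im) (masterField ν v t (ρ t) i j).im t :=
    fun i j => Complex.imCLM.hasFDerivAt.comp_hasDerivAt t (hd i j)
  have h1 := hre 0 0
  have h2 := hre 0 1
  have h3 := him 0 1
  rw [e1] at h1
  rw [e2] at h2
  rw [e3] at h3
  have := ((((h1.const_mul 2).sub_const 1).fun_pow 2).fun_add ((h2.const_mul 2).fun_pow 2)).fun_add
    ((h3.const_mul 2).fun_pow 2)
  refine this.congr_deriv ?_
  norm_num
  ring

/-- No continuous choice `m` of the signed Bloch length of a solution overtakes the optimal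
signed Bloch length. -/
theorem IsSolution.signedLength_le {ν : ℝ} (h0 : 0 ≤ ν) (h1 : ν < 1) {s T : ℝ} (hT : 0 ≤ T)
    {v : Controls} {ρ : ℝ → Mat2} (h : IsSolution ν (Icc 0 T) v ρ) {m : ℝ → ℝ}
    (hm : ContinuousOn m (Icc 0 T)) (hmQ : ∀ t ∈ Icc 0 T, m t ^ 2 = blochSq (ρ t))
    (hinit : m 0 ≤ lenStar ν s) : m T ≤ lenStar ν (s + T) := by
  have hmono : Monotone fun t => lenStar ν (s + t) :=
    (lenStar_strictMono h0 h1).monotone.comp (add_right_mono (a := s))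
  have hcount : {t : ℝ | ((s + t : ℝ) : EReal) = switchTime ν}.Countable :=
    (countable_switch ν).preimage (add_right_injective s)
  have hderiv : ∀ t : ℝ, ((s + t : ℝ) : EReal) ≠ switchTime ν →
      HasDerivAt (fun t => lenStar ν (s + t)) (coolingRate ν (lenStar ν (s + t))) t := fun t ht =>
    (lenStar_hasDerivAt h0 h1 ht).comp_const_add s t
  refine comparison (n := fun t => lenStar ν (s + t)) hT hm (h.blochSq_absolutelyContinuous hT)
    ?_ (hmono.monotoneOn _) hmQ ?_ (by simpa using hinit)
  · exact (hmono.monotoneOn _).absolutelyContinuousOnInterval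
      ((lenStar_continuous h0 h1).comp (continuous_const_add s)).continuousOn hcount
      fun t ht => (hderiv t ht.2).differentiableAt
  · have hmaster := (ae_restrict_iff' measurableSet_Icc).1 h.master
    filter_upwards [hmaster, hcount.ae_notMem volume] with t hd ht htT hle
    have htI := Ioo_subset_Icc_self htT
    have hden := h.density t htI
    have hsq := hmQ t htI
    rw [(blochSq_hasDerivAt hden (hd htI)).deriv, (hderiv t ht).deriv]
    have hb := sq_growth_bound h0 h1 (m := m t) (x := 2 * (ρ t 0 1).re) (y := 2 * (ρ t 0 1).im)
      (z := 2 * (ρ t 0 0).re - 1) hsq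
    -- Where m is ahead of n, the maximal rate available to m is at most the rate of n.
    have hanti := coolingRate_antitone h0 h1 hle
    have : m t ^ 2 * coolingRate ν (m t) ≤ m t ^ 2 * coolingRate ν (lenStar ν (s + t)) :=
      mul_le_mul_of_nonneg_left hanti (sq_nonneg _)
    linarith

/-! ### Optimality in terms of reduced states -/

theorem lamStar_eq (ν t : ℝ) : lamStar ν t = (1 + lenStar ν t) / 2 := by
  rw [lenStar]; ring

theorem lamStar_max_value {ν : ℝ} (h0 : 0 ≤ ν) (h1 : ν < 1) {s T : ℝ} (hT : 0 ≤ T)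
    {v : Controls} {σ : ℝ → Mat2} {m : ℝ → ℝ} (h : IsSolution ν (Icc 0 T) v σ)
    (hm : IsReducedPath (Icc 0 T) σ m) (hinit : m 0 = lamStar ν s) :
    m T ≤ lamStar ν (s + T) := by
  have := h.signedLength_le h0 h1 (s := s) hT (m := fun t => 2 * m t - 1)
    ((continuousOn_const.mul hm.1).sub continuousOn_const)
    (fun t ht => (hm.2 t ht).sq_eq (h.density t ht)) (by simp [hinit, lenStar])
  rw [lamStar_eq]
  linarith

theorem lamStar_strictMono {ν : ℝ} (h0 : 0 ≤ ν) (h1 : ν < 1) : StrictMono (lamStar ν) := by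
  intro s t hst
  have := lenStar_strictMono h0 h1 hst
  rw [lamStar_eq, lamStar_eq]
  linarith

theorem lamStar_mem_Icc {ν : ℝ} (h0 : 0 ≤ ν) (h1 : ν < 1) {t : ℝ} (ht : 0 ≤ t) :
    lamStar ν t ∈ Icc (0 : ℝ) 1 := by
  have h2 := neg_one_le_lenStar h0 h1 ht
  have h3 := lenStar_lt_one h0 h1 t
  rw [lamStar_eq]
  constructor <;> linarith

theorem mem_stdSimplex_pair {l : ℝ} (h : l ∈ Icc (0 : ℝ) 1) :
    ![l, 1 - l] ∈ stdSimplex ℝ (Fin 2) := by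
  refine ⟨fun i => ?_, by simp⟩
  fin_cases i
  · exact h.1
  · simpa using h.2

/-- The comparison is applied to the unsigned length √Q, which is automatically continuous; λ*(s) ≥
1/2 is what makes it start at `lenStar ν s`. Bounding it bounds both eigenvalues, which on the
simplex is majorization. -/
theorem lamStar_max_measure {ν : ℝ} (h0 : 0 ≤ ν) (h1 : ν < 1) {s T : ℝ} (hs : 0 ≤ s)
    (hls : 1 / 2 ≤ lamStar ν s) (hT : 0 ≤ T) {v : Controls} {σ : ℝ → Mat2}
    (h : IsSolution ν (Icc 0 T) v σ) (hinit : HasReducedState (σ 0) (lamStar ν s)) {m : ℝ}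
    (hm : HasReducedState (σ T) m) {f : (Fin 2 → ℝ) → ℝ} (hf : SchurConvex f) :
    f ![m, 1 - m] ≤ f ![lamStar ν (s + T), 1 - lamStar ν (s + T)] := by
  have hQc : ContinuousOn (fun t => blochSq (σ t)) (Icc 0 T) := by
    simpa [uIcc_of_le hT] using (h.blochSq_absolutelyContinuous hT).continuousOn
  have hQ0 : ∀ ρ : Mat2, 0 ≤ blochSq ρ := fun ρ => by unfold blochSq; positivity
  have hlen : 0 ≤ lenStar ν s := by rw [lenStar]; linarith
  have hdT := h.density T (right_mem_Icc.2 hT)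
  have hle := h.signedLength_le h0 h1 (s := s) hT (m := fun t => Real.sqrt (blochSq (σ t)))
    hQc.sqrt (fun t _ => Real.sq_sqrt (hQ0 _)) (by
      rw [← hinit.sq_eq (h.density 0 (left_mem_Icc.2 hT)), Real.sqrt_sq]
      · rfl
      · exact hlen)
  have habs : |2 * m - 1| ≤ lenStar ν (s + T) := by
    rw [← Real.sqrt_sq_eq_abs, hm.sq_eq hdT]; exact hle
  have hm1 : |2 * m - 1| ≤ 1 := by
    rw [← Real.sqrt_sq_eq_abs, hm.sq_eq hdT, Real.sqrt_le_one]
    exact hdT.blochSq_le_one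
  obtain ⟨ha, hb⟩ := abs_le.1 habs
  obtain ⟨hc, hd⟩ := abs_le.1 hm1
  have hl := lamStar_mem_Icc h0 h1 (add_nonneg hs hT)
  rw [lenStar] at ha hb
  refine hf _ (mem_stdSimplex_pair hl) _ (mem_stdSimplex_pair ⟨by linarith, by linarith⟩) ⟨?_, ?_⟩
  · have h2 : lamStar ν s ≤ lamStar ν (s + T) :=
      (lamStar_strictMono h0 h1).monotone (by linarith)
    refine max_le (le_max_of_le_left ?_) (le_max_of_le_left ?_)
    · simp; linarith
    · simp; linarith
  · simp

end QubitCooling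

end

noncomputable section

/-- The derivative of a monotone function is locally integrable. -/
theorem Monotone.locallyIntegrable_deriv {f : ℝ → ℝ} (hf : Monotone f) :
    LocallyIntegrable (deriv f) volume := by
  intro x
  refine ⟨Icc (x - 1) (x + 1), Icc_mem_nhds (by linarith) (by linarith), ?_⟩
  rw [← intervalIntegrable_iff_integrableOn_Icc_of_le (by linarith)]
  exact (hf.monotoneOn _).intervalIntegrable_deriv

namespace QubitCooling

/-! ### The optimal path in the Bloch ball -/

/-- The distance of the optimal path from the axis of the Bloch ball. -/
def blochX (ν t : ℝ) : ℝ := Real.sqrt (max (lenStar ν t) (critHeight ν) ^ 2 - critHeight ν ^ 2)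

/-- The height of the optimal path in the Bloch ball. -/
def blochZ (ν t : ℝ) : ℝ := min (lenStar ν t) (critHeight ν)

section Bloch

variable {ν t : ℝ}

theorem blochX_of_le (h0 : 0 ≤ ν) (h1 : ν < 1) (ht : (t : EReal) ≤ switchTime ν) :
    blochX ν t = 0 := by
  rw [blochX, max_eq_right (lenStar_le_critHeight h0 h1 ht)]; simp

theorem blochZ_of_le (h0 : 0 ≤ ν) (h1 : ν < 1) (ht : (t : EReal) ≤ switchTime ν) :
    blochZ ν t = lenStar ν t :=
  min_eq_left (lenStar_le_critHeight h0 h1 ht)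

theorem blochX_of_gt (h0 : 0 ≤ ν) (h1 : ν < 1) (ht : switchTime ν < (t : EReal)) :
    blochX ν t = Real.sqrt (lenStar ν t ^ 2 - critHeight ν ^ 2) := by
  rw [blochX, max_eq_left (critHeight_lt_lenStar h0 h1 ht).le]

theorem blochZ_of_gt (h0 : 0 ≤ ν) (h1 : ν < 1) (ht : switchTime ν < (t : EReal)) :
    blochZ ν t = critHeight ν :=
  min_eq_right (critHeight_lt_lenStar h0 h1 ht).le

theorem blochX_radicand_pos (h0 : 0 ≤ ν) (h1 : ν < 1) (ht : switchTime ν < (t : EReal)) :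
    0 < lenStar ν t ^ 2 - critHeight ν ^ 2 := by
  have := critHeight_lt_lenStar h0 h1 ht
  have := critHeight_pos h0 h1
  nlinarith

theorem blochX_pos (h0 : 0 ≤ ν) (h1 : ν < 1) (ht : switchTime ν < (t : EReal)) :
    0 < blochX ν t := by
  rw [blochX_of_gt h0 h1 ht]
  exact Real.sqrt_pos.2 (blochX_radicand_pos h0 h1 ht)

theorem blochX_sq (h0 : 0 ≤ ν) (h1 : ν < 1) (ht : switchTime ν < (t : EReal)) :
    blochX ν t ^ 2 = lenStar ν t ^ 2 - critHeight ν ^ 2 := by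
  rw [blochX_of_gt h0 h1 ht, Real.sq_sqrt (blochX_radicand_pos h0 h1 ht).le]

theorem lenStar_pos (h0 : 0 ≤ ν) (h1 : ν < 1) (ht : switchTime ν < (t : EReal)) :
    0 < lenStar ν t :=
  (critHeight_pos h0 h1).trans (critHeight_lt_lenStar h0 h1 ht)

theorem blochX_monotone (h0 : 0 ≤ ν) (h1 : ν < 1) : Monotone (blochX ν) := by
  intro s t hst
  have hz := critHeight_pos h0 h1
  have h2 := (lenStar_strictMono h0 h1).monotone hst
  have h3 : 0 ≤ max (lenStar ν s) (critHeight ν) := hz.le.trans (le_max_right _ _)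
  unfold blochX
  gcongr

theorem blochZ_monotone (h0 : 0 ≤ ν) (h1 : ν < 1) : Monotone (blochZ ν) :=
  fun _ _ hst => min_le_min_right _ ((lenStar_strictMono h0 h1).monotone hst)

theorem blochX_continuous (h0 : 0 ≤ ν) (h1 : ν < 1) : Continuous (blochX ν) := by
  have := lenStar_continuous h0 h1
  unfold blochX; fun_prop

theorem blochZ_continuous (h0 : 0 ≤ ν) (h1 : ν < 1) : Continuous (blochZ ν) :=
  (lenStar_continuous h0 h1).min continuous_const

theorem lenStar_hasDerivAt_of_gt (h0 : 0 ≤ ν) (h1 : ν < 1) (ht : switchTime ν < (t : EReal)) :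
    HasDerivAt (lenStar ν) ((1 - ν) ^ 2 / 2 * (1 / lenStar ν t - lenStar ν t)) t := by
  have := lenStar_hasDerivAt h0 h1 ht.ne'
  rwa [coolingRate, if_neg (not_le.2 (critHeight_lt_lenStar h0 h1 ht))] at this

theorem blochX_hasDerivAt_of_lt (h0 : 0 ≤ ν) (h1 : ν < 1) (ht : (t : EReal) < switchTime ν) :
    HasDerivAt (blochX ν) 0 t := by
  refine (hasDerivAt_const t (0 : ℝ)).congr_of_eventuallyEq ?_
  filter_upwards [eventually_lt_switchTime ht] with s hs
  exact blochX_of_le h0 h1 hs.le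

theorem blochZ_hasDerivAt_of_lt (h0 : 0 ≤ ν) (h1 : ν < 1) (ht : (t : EReal) < switchTime ν) :
    HasDerivAt (blochZ ν) ((1 - ν ^ 2) - (1 + ν ^ 2) * blochZ ν t) t := by
  rw [blochZ_of_le h0 h1 ht.le, lenStar_of_le ht.le]
  refine (axisLen_hasDerivAt ν t).congr_of_eventuallyEq ?_
  filter_upwards [eventually_lt_switchTime ht] with s hs
  rw [blochZ_of_le h0 h1 hs.le, lenStar_of_le hs.le]

theorem blochZ_hasDerivAt_of_gt (h0 : 0 ≤ ν) (h1 : ν < 1) (ht : switchTime ν < (t : EReal)) :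
    HasDerivAt (blochZ ν) 0 t := by
  refine (hasDerivAt_const t (critHeight ν)).congr_of_eventuallyEq ?_
  filter_upwards [eventually_switchTime_lt ht] with s hs
  exact blochZ_of_gt h0 h1 hs

theorem blochX_hasDerivAt_of_gt (h0 : 0 ≤ ν) (h1 : ν < 1) (ht : switchTime ν < (t : EReal)) :
    HasDerivAt (blochX ν)
      (2 * (ν * critHeight ν / blochX ν t) * critHeight ν - (1 - ν) ^ 2 / 2 * blochX ν t) t := by
  have hn := lenStar_pos h0 h1 ht
  have hX := blochX_pos h0 h1 ht
  have hsq := blochX_sq h0 h1 ht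
  have h2 := (((lenStar_hasDerivAt_of_gt h0 h1 ht).fun_pow 2).sub_const (critHeight ν ^ 2)).sqrt
    (blochX_radicand_pos h0 h1 ht).ne'
  refine (h2.congr_of_eventuallyEq ?_).congr_deriv ?_
  · filter_upwards [eventually_switchTime_lt ht] with s hs
    exact blochX_of_gt h0 h1 hs
  · rw [← blochX_of_gt h0 h1 ht]
    have hc := critHeight_mul h0
    have hc2 := one_sub_critHeight_sq h0
    norm_num
    field_simp
    rw [hsq]
    have : (1 - ν) ^ 2 = (1 + ν) ^ 2 * critHeight ν ^ 2 := by rw [← hc]; ring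
    rw [this]
    linear_combination critHeight ν ^ 2 * hc2

/-- Monotonicity is essential: for ν > 0 the function leaves zero like a square root at the
switching time and is not Lipschitz there. -/
theorem blochX_absolutelyContinuous (h0 : 0 ≤ ν) (h1 : ν < 1) (a b : ℝ) :
    AbsolutelyContinuousOnInterval (blochX ν) a b :=
  ((blochX_monotone h0 h1).monotoneOn _).absolutelyContinuousOnInterval
    (blochX_continuous h0 h1).continuousOn (countable_switch ν) fun t ht => by
      rcases lt_or_gt_of_ne ht.2 with h | h
      · exact (blochX_hasDerivAt_of_lt h0 h1 h).differentiableAt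
      · exact (blochX_hasDerivAt_of_gt h0 h1 h).differentiableAt

theorem blochZ_absolutelyContinuous (h0 : 0 ≤ ν) (h1 : ν < 1) (a b : ℝ) :
    AbsolutelyContinuousOnInterval (blochZ ν) a b :=
  ((blochZ_monotone h0 h1).monotoneOn _).absolutelyContinuousOnInterval
    (blochZ_continuous h0 h1).continuousOn (countable_switch ν) fun t ht => by
      rcases lt_or_gt_of_ne ht.2 with h | h
      · exact (blochZ_hasDerivAt_of_lt h0 h1 h).differentiableAt
      · exact (blochZ_hasDerivAt_of_gt h0 h1 h).differentiableAt

/-! ### The rotation angle -/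

theorem yStar_of_le (ht : (t : EReal) ≤ switchTime ν) : yStar ν t = 0 := by
  rw [yStar, if_pos ht]

theorem pi_mul_yStar_of_gt (ht : switchTime ν < (t : EReal)) :
    Real.pi * yStar ν t =
      Real.arcsin (Real.sqrt (1 / 2 * (1 - critHeight ν / lenStar ν t))) := by
  rw [yStar, if_neg (not_le.2 ht), ← mul_assoc, mul_one_div_cancel Real.pi_ne_zero, one_mul]
  have : 1 - 2 * lamStar ν t = -lenStar ν t := by rw [lenStar]; ring
  rw [this, ← critHeight, one_div_neg_eq_neg_one_div, mul_neg, mul_one_div, sub_eq_add_neg]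

theorem critHeight_div_lenStar (h0 : 0 ≤ ν) (h1 : ν < 1) (ht : switchTime ν < (t : EReal)) :
    critHeight ν / lenStar ν t ∈ Ioo (0 : ℝ) 1 :=
  ⟨div_pos (critHeight_pos h0 h1) (lenStar_pos h0 h1 ht),
    (div_lt_one (lenStar_pos h0 h1 ht)).2 (critHeight_lt_lenStar h0 h1 ht)⟩

theorem cos_two_pi_yStar (h0 : 0 ≤ ν) (h1 : ν < 1) (ht : switchTime ν < (t : EReal)) :
    Real.cos (2 * Real.pi * yStar ν t) = critHeight ν / lenStar ν t := by
  obtain ⟨h2, h3⟩ := critHeight_div_lenStar h0 h1 ht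
  rw [mul_assoc, pi_mul_yStar_of_gt ht, Real.cos_two_mul', Real.cos_sq', Real.sin_arcsin,
    Real.sq_sqrt (by linarith)]
  · ring
  · linarith [Real.sqrt_nonneg (1 / 2 * (1 - critHeight ν / lenStar ν t))]
  · rw [Real.sqrt_le_one]; linarith

theorem two_pi_yStar_mem (ht : switchTime ν < (t : EReal)) :
    2 * Real.pi * yStar ν t ∈ Icc 0 Real.pi := by
  rw [mul_assoc, pi_mul_yStar_of_gt ht]
  have h2 := Real.arcsin_nonneg.2 (Real.sqrt_nonneg (1 / 2 * (1 - critHeight ν / lenStar ν t)))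
  have h3 := Real.arcsin_le_pi_div_two (Real.sqrt (1 / 2 * (1 - critHeight ν / lenStar ν t)))
  constructor <;> linarith

theorem sin_two_pi_yStar (h0 : 0 ≤ ν) (h1 : ν < 1) (ht : switchTime ν < (t : EReal)) :
    Real.sin (2 * Real.pi * yStar ν t) = blochX ν t / lenStar ν t := by
  have hn := lenStar_pos h0 h1 ht
  have hmem := two_pi_yStar_mem ht
  have h2 := Real.sin_nonneg_of_nonneg_of_le_pi hmem.1 hmem.2
  rw [← sq_eq_sq₀ h2 (div_nonneg (blochX_pos h0 h1 ht).le hn.le), Real.sin_sq,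
    cos_two_pi_yStar h0 h1 ht, div_pow, div_pow, blochX_sq h0 h1 ht]
  field_simp

/-- Replaces the arcsine of a square root by a form that is easier to differentiate. -/
theorem pi_mul_yStar_eq_arccos (h0 : 0 ≤ ν) (h1 : ν < 1) (ht : switchTime ν < (t : EReal)) :
    Real.pi * yStar ν t = Real.arccos (critHeight ν / lenStar ν t) / 2 := by
  have hmem := two_pi_yStar_mem ht
  rw [← cos_two_pi_yStar h0 h1 ht, Real.arccos_cos hmem.1 hmem.2]
  ring

theorem directTerm_eq (h0 : 0 ≤ ν) (h1 : ν < 1) (ht : switchTime ν < (t : EReal)) :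
    directTerm ν (lamStar ν t) = critHeight ν / lenStar ν t / blochX ν t *
      ((1 - ν) ^ 2 / 4 * (1 / lenStar ν t - lenStar ν t)) := by
  rw [directTerm, ← lenStar, ← critHeight, blochX_of_gt h0 h1 ht]
  ring

theorem compensatingTerm_eq (h0 : 0 ≤ ν) (h1 : ν < 1) (ht : switchTime ν < (t : EReal)) :
    compensatingTerm ν (lamStar ν t) (yStar ν t) =
      (1 - ν ^ 2) * blochX ν t / (4 * lenStar ν t ^ 2) := by
  have hn := lenStar_pos h0 h1 ht
  have hc := critHeight_mul h0
  have e : (1 + ν) * (critHeight ν / lenStar ν t) = (1 - ν) / lenStar ν t := by rw [← hc]; ring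
  rw [compensatingTerm, ← lenStar, sin_two_pi_yStar h0 h1 ht, cos_two_pi_yStar h0 h1 ht, e]
  field_simp
  ring

/-- At the critical height z the drift of the height is (1-ν²) - (1+ν²)z = 2νz, and the rotation
contributes -2uX; the sum of both terms is the u for which these cancel. -/
theorem control_eq (h0 : 0 ≤ ν) (h1 : ν < 1) (ht : switchTime ν < (t : EReal)) :
    directTerm ν (lamStar ν t) + compensatingTerm ν (lamStar ν t) (yStar ν t) =
      ν * critHeight ν / blochX ν t := by
  have hn := lenStar_pos h0 h1 ht
  have hX := blochX_pos h0 h1 ht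
  have hsq := blochX_sq h0 h1 ht
  have hc := critHeight_mul h0
  have hc2 := one_sub_critHeight_sq h0
  rw [directTerm_eq h0 h1 ht, compensatingTerm_eq h0 h1 ht]
  field_simp
  rw [hsq]
  have e1 : (1 - ν) ^ 2 = (1 + ν) ^ 2 * critHeight ν ^ 2 := by rw [← hc]; ring
  have e2 : 1 - ν ^ 2 = (1 + ν) ^ 2 * critHeight ν := by
    linear_combination -(1 + ν) * hc
  rw [e1, e2]
  linear_combination critHeight ν * lenStar ν t ^ 2 * hc2

theorem pi_mul_yStar_hasDerivAt (h0 : 0 ≤ ν) (h1 : ν < 1) (ht : switchTime ν < (t : EReal)) :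
    HasDerivAt (fun s => Real.pi * yStar ν s) (directTerm ν (lamStar ν t)) t := by
  have hn := lenStar_pos h0 h1 ht
  have hX := blochX_pos h0 h1 ht
  obtain ⟨h2, h3⟩ := critHeight_div_lenStar h0 h1 ht
  have hq := (hasDerivAt_const t (critHeight ν)).fun_div (lenStar_hasDerivAt_of_gt h0 h1 ht) hn.ne'
  have ha := ((Real.hasDerivAt_arccos (by linarith) h3.ne).comp t hq).div_const 2
  refine (ha.congr_of_eventuallyEq ?_).congr_deriv ?_
  · filter_upwards [eventually_switchTime_lt ht] with s hs
    exact pi_mul_yStar_eq_arccos h0 h1 hs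
  · have e : Real.sqrt (1 - (critHeight ν / lenStar ν t) ^ 2) = blochX ν t / lenStar ν t := by
      rw [Real.sqrt_eq_iff_eq_sq, div_pow, div_pow, blochX_sq h0 h1 ht]
      · field_simp
      · nlinarith
      · positivity
    rw [e, directTerm_eq h0 h1 ht]
    field_simp
    ring

/-! ### The optimal path as a path of matrices -/

/-- The density matrix with Bloch vector `(x, 0, z)`. -/
def planarState (x z : ℝ) : Mat2 :=
  !![(((1 + z) / 2 : ℝ) : ℂ), ((x / 2 : ℝ) : ℂ); ((x / 2 : ℝ) : ℂ), (((1 - z) / 2 : ℝ) : ℂ)]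

theorem rotY_eq (θ : ℝ) :
    rotY θ = !![(Real.cos (Real.pi * θ) : ℂ), (Real.sin (Real.pi * θ) : ℂ);
      -(Real.sin (Real.pi * θ) : ℂ), (Real.cos (Real.pi * θ) : ℂ)] := by
  set φ : ℝ := Real.pi * θ with hφ
  -- The columns (1, i) and (1, -i) are eigenvectors of `σy` for 1 and -1, so the exponential
  -- reduces to a diagonal one.
  let U : Mat2ˣ :=
    { val := !![1, 1; Complex.I, -Complex.I]
      inv := !![1 / 2, -Complex.I / 2; 1 / 2, Complex.I / 2]
      val_inv := by
        ext i j; fin_cases i <;> fin_cases j <;> simp [Matrix.mul_apply, Fin.sum_univ_two] <;>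
          ring_nf <;> simp
      inv_val := by
        ext i j; fin_cases i <;> fin_cases j <;> simp [Matrix.mul_apply, Fin.sum_univ_two] <;>
          ring_nf <;> simp <;> norm_num }
  have h : (Complex.I * (φ : ℂ)) • σy =
      (U : Mat2) * Matrix.diagonal ![Complex.I * φ, -(Complex.I * φ)] * ((U⁻¹ : Mat2ˣ) : Mat2) := by
    ext i j; fin_cases i <;> fin_cases j <;>
      simp [U, σy, Matrix.mul_apply, Fin.sum_univ_two, Units.inv_mk, Matrix.vecMul_diagonal] <;> ring_nf
  rw [rotY, ← hφ, h, Matrix.coe_units_inv, Matrix.exp_conj _ _ U.isUnit, Matrix.exp_diagonal,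
    ← Matrix.coe_units_inv]
  have e1 : NormedSpace.exp (Complex.I * (φ : ℂ)) = Complex.cos φ + Complex.sin φ * Complex.I := by
    rw [← Complex.exp_eq_exp_ℂ, mul_comm, Complex.exp_mul_I]
  have e2 : NormedSpace.exp (-(Complex.I * (φ : ℂ))) =
      Complex.cos φ - Complex.sin φ * Complex.I := by
    rw [← Complex.exp_eq_exp_ℂ, mul_comm, ← neg_mul, Complex.exp_mul_I, Complex.cos_neg,
      Complex.sin_neg]
    ring
  ext i j; fin_cases i <;> fin_cases j <;>
    simp [U, Matrix.mul_apply, Fin.sum_univ_two, Units.inv_mk, Matrix.vecMul_diagonal,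
      Pi.coe_exp, e1, e2] <;>
    ring_nf <;> simp

theorem rotY_mem (θ : ℝ) : rotY θ ∈ Matrix.specialUnitaryGroup (Fin 2) ℂ := by
  have h := Real.sin_sq_add_cos_sq (Real.pi * θ)
  have h' : (Real.sin (Real.pi * θ) : ℂ) ^ 2 + (Real.cos (Real.pi * θ) : ℂ) ^ 2 = 1 := by
    exact_mod_cast h
  rw [Matrix.mem_specialUnitaryGroup_iff, Matrix.mem_unitaryGroup_iff, rotY_eq]
  constructor
  · ext i j
    fin_cases i <;> fin_cases j <;>
      simp [Matrix.mul_apply, Fin.sum_univ_two, Matrix.star_apply, -Complex.ofReal_cos,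
        -Complex.ofReal_sin]
    · linear_combination h'
    · ring
    · ring
    · linear_combination h'
  · rw [Matrix.det_fin_two_of]; linear_combination h'

theorem rotY_conj_diagState (θ l : ℝ) :
    rotY θ * diagState l * (rotY θ).conjTranspose =
      planarState (-((2 * l - 1) * Real.sin (2 * Real.pi * θ)))
        ((2 * l - 1) * Real.cos (2 * Real.pi * θ)) := by
  rw [rotY_eq, mul_assoc 2, Real.sin_two_mul, Real.cos_two_mul']
  have h := Real.sin_sq_add_cos_sq (Real.pi * θ)
  have h' : (Real.sin (Real.pi * θ) : ℂ) ^ 2 + (Real.cos (Real.pi * θ) : ℂ) ^ 2 = 1 := by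
    exact_mod_cast h
  set c := Real.cos (Real.pi * θ)
  set s := Real.sin (Real.pi * θ)
  ext i j
  fin_cases i <;> fin_cases j <;>
    simp [planarState, diagState, Matrix.mul_apply, Fin.sum_univ_two,
      Matrix.vecMul, dotProduct]
  · linear_combination h' / 2
  · ring
  · ring
  · linear_combination h' / 2

theorem rhoStar_eq (h0 : 0 ≤ ν) (h1 : ν < 1) {ε : ℝ} (hε : ε = 1 ∨ ε = -1) (t : ℝ) :
    rhoStar ε ν t = planarState (ε * blochX ν t) (blochZ ν t) := by
  rw [rhoStar, rotY_conj_diagState, ← lenStar]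
  rcases le_or_gt (t : EReal) (switchTime ν) with ht | ht
  · rw [yStar_of_le ht, blochX_of_le h0 h1 ht, blochZ_of_le h0 h1 ht]
    simp
  · have hn := lenStar_pos h0 h1 ht
    have hs := sin_two_pi_yStar h0 h1 ht
    have hc := cos_two_pi_yStar h0 h1 ht
    rw [blochZ_of_gt h0 h1 ht]
    rcases hε with rfl | rfl
    · have e : 2 * Real.pi * (-1 * yStar ν t) = -(2 * Real.pi * yStar ν t) := by ring
      rw [e, Real.sin_neg, Real.cos_neg, hs, hc]
      congr 1 <;> field_simp
    · have e : 2 * Real.pi * (- -1 * yStar ν t) = 2 * Real.pi * yStar ν t := by ring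
      rw [e, hs, hc]
      congr 1 <;> field_simp

theorem diagState_isDensity {l : ℝ} (hl : l ∈ Icc (0 : ℝ) 1) : IsDensity (diagState l) := by
  constructor
  · refine Matrix.PosSemidef.diagonal fun i => ?_
    fin_cases i
    · simpa using hl.1
    · simpa [-Complex.ofReal_sub] using hl.2
  · simp [diagState]

theorem HasReducedState.isDensity {ρ : Mat2} {l : ℝ} (h : HasReducedState ρ l)
    (hl : l ∈ Icc (0 : ℝ) 1) : IsDensity ρ := by
  obtain ⟨U, hU, rfl⟩ := h
  refine ⟨(diagState_isDensity hl).1.mul_mul_conjTranspose_same U, ?_⟩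
  have hUU : U.conjTranspose * U = 1 :=
    Matrix.mem_unitaryGroup_iff'.1 (Matrix.mem_specialUnitaryGroup_iff.1 hU).1
  rw [Matrix.trace_mul_comm, ← mul_assoc, hUU, one_mul, (diagState_isDensity hl).2]

theorem rhoStar_hasReducedState (ε ν t : ℝ) : HasReducedState (rhoStar ε ν t) (lamStar ν t) :=
  ⟨_, rotY_mem _, rfl⟩

theorem masterField_planarState (ν : ℝ) {u : Controls} {t : ℝ} (hx : u.x t = 0) (hz : u.z t = 0)
    (x z : ℝ) :
    masterField ν u t (planarState x z) =
      !![(((-(2 * u.y t * x) + (1 - ν ^ 2) - (1 + ν ^ 2) * z) / 2 : ℝ) : ℂ),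
        (((2 * u.y t * z - (1 - ν) ^ 2 / 2 * x) / 2 : ℝ) : ℂ);
        (((2 * u.y t * z - (1 - ν) ^ 2 / 2 * x) / 2 : ℝ) : ℂ),
        ((-((-(2 * u.y t * x) + (1 - ν ^ 2) - (1 + ν ^ 2) * z) / 2) : ℝ) : ℂ)] := by
  simp only [masterField, dissipator, lindbladTerm_conjTranspose, Controls.hamiltonian, hx, hz]
  ext i j
  fin_cases i <;> fin_cases j <;>
  · simp [lindbladTerm, planarState, σx, σy, σz, Ring.lie_def]
    ring_nf
    simp
    try ring

/-! ### The optimal controls -/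

theorem optimalControls_y (h0 : 0 ≤ ν) (h1 : ν < 1) (ε : ℝ) (ht : switchTime ν < (t : EReal)) :
    (optimalControls ε ν).y t = ε * (ν * critHeight ν / blochX ν t) := by
  simp only [optimalControls]
  rw [if_neg (not_le.2 ht), control_eq h0 h1 ht]

/-- Solving X' = 2uz - (1-ν)²X/2 for u, with z the critical height, expresses the control through X
and X'. Both are locally integrable since X is continuous and monotone, although u is unbounded near
a finite switching time. -/
theorem optimalControls_y_locallyIntegrable (h0 : 0 ≤ ν) (h1 : ν < 1) (ε : ℝ) :
    LocallyIntegrable (optimalControls ε ν).y volume := by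
  have hX : LocallyIntegrable (blochX ν) volume := (blochX_continuous h0 h1).locallyIntegrable
  have h := ((blochX_monotone h0 h1).locallyIntegrable_deriv.add
    (hX.smul ((1 - ν) ^ 2 / 2))).smul (ε / (2 * critHeight ν))
  refine h.congr ?_
  filter_upwards [(countable_switch ν).ae_notMem volume] with t ht
  have hz := critHeight_pos h0 h1
  simp only [Pi.smul_apply, Pi.add_apply, smul_eq_mul]
  rcases lt_or_gt_of_ne ht with ht | ht
  · rw [(blochX_hasDerivAt_of_lt h0 h1 ht).deriv, blochX_of_le h0 h1 ht.le]
    simp [optimalControls, ht.le]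
  · rw [(blochX_hasDerivAt_of_gt h0 h1 ht).deriv, optimalControls_y h0 h1 ε ht]
    field_simp
    ring

theorem planarState_absolutelyContinuous {x z : ℝ → ℝ} {a b : ℝ}
    (hx : AbsolutelyContinuousOnInterval x a b) (hz : AbsolutelyContinuousOnInterval z a b)
    (i j : Fin 2) : AbsolutelyContinuousOnInterval (fun t => planarState (x t) (z t) i j) a b := by
  have key : ∀ {f g : ℝ → ℝ}, AbsolutelyContinuousOnInterval f a b →
      (∀ s t, |g s - g t| = |f s - f t| / 2) →
      AbsolutelyContinuousOnInterval (fun t => (g t : ℂ)) a b := fun hf h =>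
    hf.of_dist_le (1 / 2) fun s _ t _ => by
      rw [Complex.dist_eq, ← Complex.ofReal_sub, Complex.norm_real, Real.norm_eq_abs, Real.dist_eq,
        h s t]
      linarith
  fin_cases i <;> fin_cases j
  · refine key hz fun s t => ?_
    rw [← abs_of_pos (two_pos (α := ℝ)), ← abs_div, abs_of_pos (two_pos (α := ℝ))]
    congr 1; ring
  · refine key hx fun s t => ?_
    rw [← abs_of_pos (two_pos (α := ℝ)), ← abs_div, abs_of_pos (two_pos (α := ℝ))]
    congr 1; ring
  · refine key hx fun s t => ?_
    rw [← abs_of_pos (two_pos (α := ℝ)), ← abs_div, abs_of_pos (two_pos (α := ℝ))]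
    congr 1; ring
  · refine key hz fun s t => ?_
    rw [abs_sub_comm (z s), ← abs_of_pos (two_pos (α := ℝ)), ← abs_div,
      abs_of_pos (two_pos (α := ℝ))]
    congr 1; ring

theorem planarState_hasDerivAt {x z : ℝ → ℝ} {x' z' : ℝ} (hx : HasDerivAt x x' t)
    (hz : HasDerivAt z z' t) (i j : Fin 2) :
    HasDerivAt (fun t => planarState (x t) (z t) i j)
      ((!![((z' / 2 : ℝ) : ℂ), ((x' / 2 : ℝ) : ℂ); ((x' / 2 : ℝ) : ℂ), ((-(z' / 2) : ℝ) : ℂ)] : Mat2)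
        i j) t := by
  fin_cases i <;> fin_cases j
  · exact ((hz.const_add 1).div_const 2).ofReal_comp
  · exact (hx.div_const 2).ofReal_comp
  · exact (hx.div_const 2).ofReal_comp
  · refine HasDerivAt.ofReal_comp (((hz.const_sub 1).div_const 2).congr_deriv ?_)
    ring

theorem rhoStar_isSolution (h0 : 0 ≤ ν) (h1 : ν < 1) {ε : ℝ} (hε : ε = 1 ∨ ε = -1) :
    IsSolution ν (Ici 0) (optimalControls ε ν) (rhoStar ε ν) where
  locInt_x := locallyIntegrable_zero.locallyIntegrableOn _
  locInt_y := (optimalControls_y_locallyIntegrable h0 h1 ε).locallyIntegrableOn _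
  locInt_z := locallyIntegrable_zero.locallyIntegrableOn _
  density t ht := (rhoStar_hasReducedState ε ν t).isDensity (lamStar_mem_Icc h0 h1 ht)
  absCont a _ b _ i j := by
    simp only [rhoStar_eq h0 h1 hε]
    exact planarState_absolutelyContinuous ((blochX_absolutelyContinuous h0 h1 a b).const_mul ε)
      (blochZ_absolutelyContinuous h0 h1 a b) i j
  master := by
    filter_upwards [(countable_switch ν).ae_notMem (volume.restrict (Ici 0))] with t ht i j
    simp only [rhoStar_eq h0 h1 hε]
    rw [masterField_planarState ν (u := optimalControls ε ν) rfl rfl]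
    have hεsq : ε * ε = 1 := by rcases hε with rfl | rfl <;> norm_num
    rcases lt_or_gt_of_ne ht with ht | ht
    · have hu : (optimalControls ε ν).y t = 0 := by simp [optimalControls, ht.le]
      convert planarState_hasDerivAt ((blochX_hasDerivAt_of_lt h0 h1 ht).const_mul ε)
        (blochZ_hasDerivAt_of_lt h0 h1 ht) i j using 1
      rw [hu, blochX_of_le h0 h1 ht.le]
      simp
    · have hX := blochX_pos h0 h1 ht
      have hc := critHeight_mul h0
      -- The height is stationary after the switching time.
      have hz : -(2 * (optimalControls ε ν).y t * (ε * blochX ν t)) + (1 - ν ^ 2)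
          - (1 + ν ^ 2) * blochZ ν t = 0 := by
        rw [optimalControls_y h0 h1 ε ht, blochZ_of_gt h0 h1 ht]
        field_simp
        linear_combination (-(2 * ν * critHeight ν)) * hεsq - (1 + ν) * hc
      have hx : 2 * (optimalControls ε ν).y t * blochZ ν t - (1 - ν) ^ 2 / 2 * (ε * blochX ν t) =
          ε * (2 * (ν * critHeight ν / blochX ν t) * critHeight ν
            - (1 - ν) ^ 2 / 2 * blochX ν t) := by
        rw [optimalControls_y h0 h1 ε ht, blochZ_of_gt h0 h1 ht]
        ring
      rw [hz, hx]
      exact planarState_hasDerivAt ((blochX_hasDerivAt_of_gt h0 h1 ht).const_mul ε)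
        (blochZ_hasDerivAt_of_gt h0 h1 ht) i j

theorem rhoStar_isTimeOptimalCooling (h0 : 0 ≤ ν) (h1 : ν < 1) {ε : ℝ} (hε : ε = 1 ∨ ε = -1) :
    IsTimeOptimalCooling ν (optimalControls ε ν) (rhoStar ε ν) (lamStar ν) where
  solution := rhoStar_isSolution h0 h1 hε
  reduced := by
    refine ⟨Continuous.continuousOn ?_, fun t _ => rhoStar_hasReducedState ε ν t⟩
    have := lenStar_continuous h0 h1
    simp only [funext (lamStar_eq ν)]
    fun_prop
  cools := by
    have := ((lenStar_tendsto h0 h1).const_add 1).div_const 2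
    rw [funext (lamStar_eq ν)]
    norm_num at this ⊢
    exact this
  max_value _ _ _ hT _ _ _ h hm hinit := lamStar_max_value h0 h1 hT h hm hinit
  min_time s _ t _ T hT v σ m h hm hinit hend := by
    have := lamStar_max_value h0 h1 hT h hm hinit
    rw [hend, (lamStar_strictMono h0 h1).le_iff_le] at this
    linarith
  max_measure _ hs hls _ hT _ _ h hinit _ hm _ hf :=
    lamStar_max_measure h0 h1 hs hls hT h hinit hm hf

/-- The hypothesis says that the Bloch vectors (x, 0, z) and (q, 0, p) are parallel. -/
theorem commute_planarState {x z p q : ℝ} (h : p * x = q * z) :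
    Commute (planarState x z) !![((p / 2 : ℝ) : ℂ), ((q / 2 : ℝ) : ℂ); ((q / 2 : ℝ) : ℂ),
      ((-(p / 2) : ℝ) : ℂ)] := by
  have h' : (p : ℂ) * x = q * z := by exact_mod_cast h
  ext i j
  fin_cases i <;> fin_cases j <;>
    simp [planarState, Matrix.mul_apply, Fin.sum_univ_two]
  · ring
  · linear_combination (-1 / 2) * h'
  · linear_combination (1 / 2) * h'
  · ring

theorem compensatingTerm_commute (h0 : 0 ≤ ν) (h1 : ν < 1) {ε : ℝ} (hε : ε = 1 ∨ ε = -1)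
    (ht : switchTime ν < (t : EReal)) :
    Commute (rhoStar ε ν t)
      (-(Complex.I • ⁅((ε * compensatingTerm ν (lamStar ν t) (yStar ν t) : ℝ) : ℂ) • σy,
          rhoStar ε ν t⁆) - dissipator (lindbladTerm ν) (rhoStar ε ν t)) := by
  have hn := lenStar_pos h0 h1 ht
  have hsq := blochX_sq h0 h1 ht
  have hc := critHeight_mul h0
  have hεsq : ε ^ 2 = 1 := by rcases hε with rfl | rfl <;> norm_num
  -- The compensating term is viewed as a control of its own, so that the planar formula for
  -- `masterField` applies; what remains is that the resulting velocity is radial in the Bloch ball.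
  let u : Controls :=
    ⟨fun _ => 0, fun _ => ε * compensatingTerm ν (lamStar ν t) (yStar ν t), fun _ => 0⟩
  have hfield : ∀ ρ : Mat2, -(Complex.I •
      ⁅((ε * compensatingTerm ν (lamStar ν t) (yStar ν t) : ℝ) : ℂ) • σy, ρ⁆)
        - dissipator (lindbladTerm ν) ρ = masterField ν u t ρ := fun ρ => by
    simp [masterField, Controls.hamiltonian, u]
  rw [hfield, rhoStar_eq h0 h1 hε, masterField_planarState ν (u := u) rfl rfl,
    blochZ_of_gt h0 h1 ht]
  refine commute_planarState ?_
  simp only [u]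
  have hC : compensatingTerm ν (lamStar ν t) (yStar ν t) * (4 * lenStar ν t ^ 2) =
      (1 - ν ^ 2) * blochX ν t := by
    rw [compensatingTerm_eq h0 h1 ht]; field_simp
  generalize compensatingTerm ν (lamStar ν t) (yStar ν t) = C at hC ⊢
  have e1 : (1 - ν) ^ 2 = (1 + ν) ^ 2 * critHeight ν ^ 2 := by rw [← hc]; ring
  have e2 : 1 - ν ^ 2 = (1 + ν) ^ 2 * critHeight ν := by
    linear_combination -(1 + ν) * hc
  have e3 : 2 * (1 + ν ^ 2) = (1 + ν) ^ 2 * (1 + critHeight ν ^ 2) := by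
    linear_combination e1
  linear_combination (-2 * C * blochX ν t * ε * blochX ν t) * hεsq
    - 2 * C * ε * hsq - ε / 2 * hC + ε * blochX ν t / 2 * e2
    - ε * blochX ν t * critHeight ν / 2 * e3 + ε * blochX ν t * critHeight ν / 2 * e1

end Bloch

end QubitCooling

end

theorem mainTheorem5 (ν : ℝ) (hν0 : 0 ≤ ν) (hν1 : ν < 1) (ε : ℝ) (hε : ε = 1 ∨ ε = -1) :
    -- the path starts in the pure state `diag(0, 1)`
    QubitCooling.rhoStar ε ν 0 = QubitCooling.diagState 0 ∧
    QubitCooling.lamStar ν 0 = 0 ∧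
    -- the controls steer the system along `ρ*` and are time-optimal
    QubitCooling.IsTimeOptimalCooling ν (QubitCooling.optimalControls ε ν)
      (QubitCooling.rhoStar ε ν) (QubitCooling.lamStar ν) ∧
    -- the direct term is the angular velocity of the diagonalizing unitary
    (∀ t : ℝ, QubitCooling.switchTime ν < (t : EReal) →
      HasDerivAt (fun s => Real.pi * QubitCooling.yStar ν s)
        (QubitCooling.directTerm ν (QubitCooling.lamStar ν t)) t) ∧
    -- the compensating term cancels the drift tangent to the unitary orbit
    (∀ t : ℝ, QubitCooling.switchTime ν < (t : EReal) →
      Commute (QubitCooling.rhoStar ε ν t)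
        (-(Complex.I • ⁅((ε * QubitCooling.compensatingTerm ν (QubitCooling.lamStar ν t)
              (QubitCooling.yStar ν t) : ℝ) : ℂ) • QubitCooling.σy, QubitCooling.rhoStar ε ν t⁆)
          - QubitCooling.dissipator (QubitCooling.lindbladTerm ν)
              (QubitCooling.rhoStar ε ν t))) := by
  have hzero : QubitCooling.lamStar ν 0 = 0 := by
    rw [QubitCooling.lamStar_eq, QubitCooling.lenStar_zero hν0 hν1]; norm_num
  have hswitch : ((0 : ℝ) : EReal) ≤ QubitCooling.switchTime ν := by
    simpa using (QubitCooling.zero_lt_switchTime hν0 hν1).le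
  refine ⟨?_, hzero, QubitCooling.rhoStar_isTimeOptimalCooling hν0 hν1 hε,
    fun t ht => QubitCooling.pi_mul_yStar_hasDerivAt hν0 hν1 ht,
    fun t ht => QubitCooling.compensatingTerm_commute hν0 hν1 hε ht⟩
  rw [QubitCooling.rhoStar, hzero, QubitCooling.yStar_of_le hswitch, mul_zero,
    QubitCooling.rotY_conj_diagState]
  ext i j
  fin_cases i <;> fin_cases j <;> simp [QubitCooling.planarState, QubitCooling.diagState]
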